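/- Let $X$ be a scheme smooth over $\operatorname{Spec}\mathbb Z$, let $Z\subset X$ be a closed subscheme with ideal sheaf $I$ that is smooth over $\operatorname{Spec}\mathbb Z$, and let $\pi\colon B_ZX=\operatorname{Proj}\bigoplus_{m\ge 0}I^m\to X$ be the blow-up of $X$ in $Z$. For a prime ideal $(p)\subseteq\mathbb Z$ ($p=0$ allowed) write $(-)_p$ for the scheme-theoretic fibre over the point $(p)$ of $\operatorname{Spec}\mathbb Z$. (1) (The fibre of the blow-up is the blow-up of the fibre.) For every prime ideal $(p)\subseteq\mathbb Z$ there is an isomorphism $(B_ZX)_p\cong B_{Z_p}X_p$ under which the projection $(B_ZX)_p\to B_ZX$ followed by $\pi$ equals the blow-up morphism $\pi_p\colon B_{Z_p}X_p\to X_p$ followed by the projection $X_p\to X$. (2) (Local blow-up coordinates.) Let $(p)\subseteq\mathbb Z$ be a prime ideal, let $x'\in B_ZX$ be a point lying in the fibre over $(p)$ and closed in $(B_ZX)_p$, and put $x=\pi(x')$. Let $1\le r\le n$ and let $x_1,\dots,x_n\in\mathcal O_{X,x}$ be such that $p,x_1,\dots,x_n$ (if $p\ne0$), respectively $x_1,\dots,x_n$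 (if $p=0$), is a regular system of parameters of $\mathcal O_{X,x}$ and such that $Z$ is defined at $x$ by $x_1,\dots,x_r$, i.e. $I_x=(x_1,\dots,x_r)$. Assume that $x'$ lies in the $x_1$-chart of the blow-up. Then $x_1$ is a non-zero-divisor in $\mathcal O_{B_ZX,x'}$ and generates $I_x\mathcal O_{B_ZX,x'}$, the ideal of the exceptional divisor. Hence there are unique elements of $\mathcal O_{B_ZX,x'}$ $$\bar x_1=x_1,\quad \bar x_2=\frac{x_2}{x_1},\ \dots,\ \bar x_r=\frac{x_r}{x_1},\quad \bar x_{r+1}=x_{r+1},\ \dots,\ \bar x_n=x_n ,$$ and those of them that vanish at $x'$ are part of a system of regular parameters at $x'$: there are $y_1,\dots,y_n\in\mathcal O_{B_ZX,x'}$ with $y_i=\bar x_i$ for every $i$ such that $\bar x_i$ lies in the maximal ideal of $\mathcal O_{B_ZX,x'}$, such that $p,y_1,\dots,y_n$ (if $p\neq0$), respectively $y_1,\dots,y_n$ (if $p=0$), is a regular system of parameters of $\mathcal O_{B_ZX,x'}$. In particular, if all $\bar x_i$ vanish at $x'$ (that is, $x'$ is the origin of the $x_1$-chart over $x$), then $p,\bar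 x_1,\dots,\bar x_n$ (if $p\ne 0$), respectively $\bar x_1,\dots,\bar x_n$ (if $p=0$), is a regular system of parameters of $\mathcal O_{B_ZX,x'}$. -/

import Mathlib

universe u

open AlgebraicGeometry CategoryTheory

namespace BlowUp

open Limits Polynomial

section Rees

variable {R : Type u} [CommRing R] (I : Ideal R)

/-- The degree `n` part `Iⁿ tⁿ` of the Rees algebra `R[It] = ⨁ₙ Iⁿ tⁿ`. -/
noncomputable def reesGrading (n : ℕ) : Submodule R (reesAlgebra I) :=
  (LinearMap.range (monomial n : R →ₗ[R] R[X])).comap (reesAlgebra I).val.toLinearMap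

variable {I}

lemma mem_reesGrading_iff {n : ℕ} {p : reesAlgebra I} :
    p ∈ reesGrading I n ↔ p.1 = monomial n (p.1.coeff n) := by
  constructor
  · rintro ⟨r, hr⟩
    have hr' : monomial n r = p.1 := hr
    rw [← hr', coeff_monomial_same]
  · intro h
    exact ⟨_, h.symm⟩

lemma coeff_of_mem_reesGrading {n m : ℕ} {p : reesAlgebra I} (hp : p ∈ reesGrading I n)
    (h : n ≠ m) : p.1.coeff m = 0 := by
  rw [mem_reesGrading_iff.mp hp, coeff_monomial_of_ne _ h.symm]

variable (I)

/-- The homogeneous element `r tⁿ` of the Rees algebra, for `r ∈ Iⁿ`. -/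
noncomputable def reesMonomial (n : ℕ) (r : R) (hr : r ∈ I ^ n) : reesAlgebra I :=
  ⟨monomial n r, reesAlgebra.monomial_mem.mpr hr⟩

lemma reesMonomial_mem (n : ℕ) (r : R) (hr : r ∈ I ^ n) :
    reesMonomial I n r hr ∈ reesGrading I n := ⟨r, rfl⟩

variable {I} in
lemma eq_reesMonomial {n : ℕ} {p : reesAlgebra I} (hp : p ∈ reesGrading I n) :
    p = reesMonomial I n (p.1.coeff n) (p.2 n) :=
  Subtype.ext (mem_reesGrading_iff.mp hp)

instance : SetLike.GradedMonoid (reesGrading I) where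
  one_mem := ⟨1, by simp [monomial_zero_left]⟩
  mul_mem := by
    rintro i j p q ⟨a, ha⟩ ⟨b, hb⟩
    refine ⟨a * b, ?_⟩
    have ha' : monomial i a = p.1 := ha
    have hb' : monomial j b = q.1 := hb
    change _ = p.1 * q.1
    rw [← ha', ← hb', monomial_mul_monomial]

lemma coeff_coeAddMonoidHom_reesGrading (d : DirectSum ℕ fun i ↦ reesGrading I i) (n : ℕ) :
    (DirectSum.coeAddMonoidHom (reesGrading I) d).1.coeff n = (d n).1.1.coeff n := by
  classical
  induction d using DirectSum.induction_on with
  | zero => simp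
  | of i x =>
    rw [DirectSum.coeAddMonoidHom_of]
    by_cases h : i = n
    · subst h
      simp
    · rw [coeff_of_mem_reesGrading x.2 h, DirectSum.of_eq_of_ne _ _ _ (Ne.symm h)]
      simp
  | add x y hx hy => simp [hx, hy]

noncomputable instance : DirectSum.Decomposition (reesGrading I) where
  decompose' p := ∑ i ∈ p.1.support, DirectSum.of (fun i ↦ reesGrading I i) i
    ⟨reesMonomial I i (p.1.coeff i) (p.2 i), reesMonomial_mem I _ _ _⟩
  left_inv p := by
    apply Subtype.ext
    simp only [map_sum, DirectSum.coeAddMonoidHom_of, AddSubmonoidClass.coe_finsetSum,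
      reesMonomial]
    exact p.1.as_sum_support.symm
  right_inv d := by
    have inj : Function.Injective (DirectSum.coeAddMonoidHom (reesGrading I)) := by
      intro e e' he
      refine DFinsupp.ext fun n ↦ Subtype.ext (Subtype.ext ?_)
      rw [mem_reesGrading_iff.mp (e n).2, mem_reesGrading_iff.mp (e' n).2,
        ← coeff_coeAddMonoidHom_reesGrading I e n, ← coeff_coeAddMonoidHom_reesGrading I e' n, he]
    apply inj
    apply Subtype.ext
    simp only [map_sum, DirectSum.coeAddMonoidHom_of, AddSubmonoidClass.coe_finsetSum,
      reesMonomial]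
    exact (Polynomial.as_sum_support _).symm

noncomputable instance : GradedAlgebra (reesGrading I) where

variable {S : Type u} [CommRing S] {J : Ideal S}

/-- A ring map `φ : R → S` with `I S ⊆ J` induces a graded ring map `R[It] → S[Jt]`. -/
noncomputable def reesMap (φ : R →+* S) (h : I.map φ ≤ J) : reesGrading I →+*ᵍ reesGrading J where
  toRingHom := (Polynomial.mapRingHom φ).restrict (reesAlgebra I) (reesAlgebra J) (by
    intro p hp i
    rw [coe_mapRingHom, coeff_map]
    exact Ideal.pow_right_mono h i (Ideal.map_pow φ I i ▸ Ideal.mem_map_of_mem φ (hp i)))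
  map_mem := by
    rintro i p ⟨r, hr⟩
    have hr' : monomial i r = p.1 := hr
    refine ⟨φ r, ?_⟩
    change _ = Polynomial.map φ p.1
    rw [← hr', Polynomial.map_monomial]

lemma reesMap_val (φ : R →+* S) (h : I.map φ ≤ J) (p : reesAlgebra I) :
    (reesMap I φ h p).1 = p.1.map φ := rfl

open HomogeneousIdeal in
lemma irrelevant_le_map_reesMap (φ : R →+* S) (h : I.map φ = J) :
    irrelevant (reesGrading J) ≤ (irrelevant (reesGrading I)).map (reesMap I φ h.le) := by
  change (irrelevant (reesGrading J)).toIdeal ≤ _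
  rw [toIdeal_irrelevant_le]
  intro i hi p hp
  change p ∈ ((irrelevant (reesGrading I)).toIdeal.map (reesMap I φ h.le))
  suffices H : ∀ (s : S) (hs : s ∈ J ^ i),
      reesMonomial J i s hs ∈ (irrelevant (reesGrading I)).toIdeal.map (reesMap I φ h.le) by
    rw [eq_reesMonomial hp]
    exact H _ _
  intro s hs
  have hs' := hs
  rw [← h, ← Ideal.map_pow] at hs'
  induction hs' using Submodule.span_induction with
  | mem x hx =>
    obtain ⟨a, ha, rfl⟩ := hx
    have : reesMonomial J i (φ a) hs = reesMap I φ h.le (reesMonomial I i a ha) := by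
      apply Subtype.ext
      rw [reesMap_val]
      simp [reesMonomial]
    rw [this]
    apply Ideal.mem_map_of_mem
    rw [HomogeneousIdeal.mem_iff, HomogeneousIdeal.mem_irrelevant_iff, GradedRing.proj_apply,
      DirectSum.decompose_of_mem_ne _ (reesMonomial_mem I i a ha) hi.ne']
  | zero =>
    convert Ideal.zero_mem _
    apply Subtype.ext
    simp [reesMonomial]
  | add x y hx hy ihx ihy =>
    have hx' : x ∈ J ^ i := by rw [← h, ← Ideal.map_pow]; exact hx
    have hy' : y ∈ J ^ i := by rw [← h, ← Ideal.map_pow]; exact hy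
    convert Ideal.add_mem _ (ihx hx') (ihy hy')
    apply Subtype.ext
    simp [reesMonomial]
  | smul a x hx ih =>
    have hx' : x ∈ J ^ i := by rw [← h, ← Ideal.map_pow]; exact hx
    convert Ideal.mul_mem_left _ (algebraMap S (reesAlgebra J) a) (ih hx')
    apply Subtype.ext
    change monomial i (a * x) = C a * monomial i x
    rw [C_mul_monomial]

end Rees

section Affine

variable {R : Type u} [CommRing R] (I : Ideal R)

/-- The blow-up `Proj R[It]` of `Spec R` in the ideal `I`. -/
noncomputable abbrev affineBlowup : Scheme.{u} := Proj (reesGrading I)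

/-- The structure morphism `Proj R[It] ⟶ Spec R`. -/
noncomputable def affineBlowupπ : affineBlowup I ⟶ Spec (.of R) :=
  Proj.toSpecZero (reesGrading I) ≫
    Spec.map (CommRingCat.ofHom (algebraMap R (reesGrading I 0)))

variable {S T : Type u} [CommRing S] [CommRing T] {J : Ideal S} {K : Ideal T}

/-- The morphism `Proj S[Jt] ⟶ Proj R[It]` induced by `φ : R → S` with `J = I S`. -/
noncomputable def affineBlowupMap (φ : R →+* S) (h : I.map φ = J) :
    affineBlowup J ⟶ affineBlowup I :=
  Proj.map (reesMap I φ h.le) (irrelevant_le_map_reesMap I φ h)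

/-- The ring map from `R` to the coordinate ring `R[It]_(s)` of the chart `D₊(s)`. -/
noncomputable def toAway (s : reesAlgebra I) :
    R →+* HomogeneousLocalization.Away (reesGrading I) s :=
  (HomogeneousLocalization.fromZeroRingHom (reesGrading I) _).comp
    (algebraMap R (reesGrading I 0))

lemma awayι_affineBlowupπ {n : ℕ} (hn : 0 < n) (s : reesAlgebra I) (hs : s ∈ reesGrading I n) :
    Proj.awayι (reesGrading I) s hs hn ≫ affineBlowupπ I =
      Spec.map (CommRingCat.ofHom (toAway I s)) := by
  rw [affineBlowupπ, Proj.awayι_toSpecZero_assoc, ← Spec.map_comp]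
  rfl

lemma toAway_val (s : reesAlgebra I) (r : R) :
    (toAway I s r).val = algebraMap (reesAlgebra I) _ (algebraMap R (reesAlgebra I) r) := rfl

lemma away_map_comp_toAway (φ : R →+* S) (h : I.map φ = J) (s : reesAlgebra I) :
    (HomogeneousLocalization.Away.map (reesMap I φ h.le) s).comp (toAway I s) =
      (toAway J (reesMap I φ h.le s)).comp φ := by
  ext r
  change (HomogeneousLocalization.mk _).val = (HomogeneousLocalization.mk _).val
  simp only [HomogeneousLocalization.val_mk]
  congr 1
  · apply Subtype.ext
    change Polynomial.map φ (C r) = C (φ r)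
    simp
  · apply Subtype.ext
    apply Subtype.ext
    change Polynomial.map φ 1 = 1
    simp

lemma awayι_affineBlowupMap_π (φ : R →+* S) (h : I.map φ = J) {n : ℕ} (hn : 0 < n)
    (s : reesAlgebra I) (hs : s ∈ reesGrading I n) :
    Proj.awayι (reesGrading J) (reesMap I φ h.le s) ((reesMap I φ h.le).map_mem hs) hn ≫
      affineBlowupMap I φ h ≫ affineBlowupπ I =
    Proj.awayι (reesGrading J) (reesMap I φ h.le s) ((reesMap I φ h.le).map_mem hs) hn ≫
      affineBlowupπ J ≫ Spec.map (CommRingCat.ofHom φ) := by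
  have e1 := Proj.awayι_comp_map (reesMap I φ h.le) (irrelevant_le_map_reesMap I φ h) hn s hs
  have e2 := awayι_affineBlowupπ J hn (reesMap I φ h.le s) ((reesMap I φ h.le).map_mem hs)
  rw [affineBlowupMap, reassoc_of% e1, awayι_affineBlowupπ, ← Spec.map_comp, reassoc_of% e2,
    ← Spec.map_comp, ← CommRingCat.ofHom_comp, ← CommRingCat.ofHom_comp, away_map_comp_toAway]
  exact h

lemma affineBlowupMap_π (φ : R →+* S) (h : I.map φ = J) :
    affineBlowupMap I φ h ≫ affineBlowupπ I =
      affineBlowupπ J ≫ Spec.map (CommRingCat.ofHom φ) :=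
  (Proj.mapAffineOpenCover (reesMap I φ h.le)
    (irrelevant_le_map_reesMap I φ h)).openCover.hom_ext _ _
      fun (s : (i : ℕ+) × reesGrading I i) ↦
        awayι_affineBlowupMap_π I φ h s.1.2 s.2.1 s.2.2

lemma affineBlowupMap_id (h : I.map (RingHom.id R) = I) :
    affineBlowupMap I (RingHom.id R) h = 𝟙 _ := by
  have : reesMap I (RingHom.id R) h.le = GradedRingHom.id (reesGrading I) := by
    refine DFunLike.ext _ _ fun p ↦ Subtype.ext ?_
    simp [reesMap_val]
  unfold affineBlowupMap
  simp only [this]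
  exact Proj.map_id

lemma affineBlowupMap_comp (φ : R →+* S) (h : I.map φ = J) (ψ : S →+* T) (h' : J.map ψ = K)
    (h'' : I.map (ψ.comp φ) = K) :
    affineBlowupMap I (ψ.comp φ) h'' = affineBlowupMap J ψ h' ≫ affineBlowupMap I φ h := by
  have : reesMap I (ψ.comp φ) h''.le = (reesMap J ψ h'.le).comp (reesMap I φ h.le) := by
    refine DFunLike.ext _ _ fun p ↦ Subtype.ext ?_
    simp [reesMap_val, Polynomial.map_map]
  unfold affineBlowupMap
  simp only [this]
  exact Proj.map_comp _ _ _ _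

lemma isPushout_of_isLocalization (M : Submonoid R) [Algebra R S] [IsLocalization M S]
    {A B : Type u} [CommRing A] [CommRing B] (a : R →+* A) (b : S →+* B) (g : A →+* B)
    (hc : g.comp a = b.comp (algebraMap R S))
    (h : letI := g.toAlgebra; IsLocalization (M.map a) B) :
    IsPushout (CommRingCat.ofHom a) (CommRingCat.ofHom (algebraMap R S)) (CommRingCat.ofHom g)
      (CommRingCat.ofHom b) := by
  algebraize [a, b, g, b.comp (algebraMap R S)]
  have : IsScalarTower R A B := .of_algebraMap_eq' hc.symm
  refine (CommRingCat.isPushout_iff_isPushout ..).mpr ?_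
  exact (Algebra.isLocalization_iff_isPushout M S).mp h

lemma isLocalization_away (M : Submonoid R) [Algebra R S] [IsLocalization M S]
    (h : I.map (algebraMap R S) = J) {n : ℕ} (s : reesAlgebra I) (hs : s ∈ reesGrading I n) :
    let := (HomogeneousLocalization.Away.map (reesMap I (algebraMap R S) h.le) s).toAlgebra
    IsLocalization (M.map (toAway I s))
      (HomogeneousLocalization.Away (reesGrading J) (reesMap I (algebraMap R S) h.le s)) := by
  let := (HomogeneousLocalization.Away.map (reesMap I (algebraMap R S) h.le) s).toAlgebra
  have key (m : R) : HomogeneousLocalization.Away.map (reesMap I (algebraMap R S) h.le) s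
      (toAway I s m) = toAway J _ (algebraMap R S m) :=
    congr($(away_map_comp_toAway I (algebraMap R S) h s) m)
  have hs' : reesMap I (algebraMap R S) h.le s ∈ reesGrading J n :=
    (reesMap I (algebraMap R S) h.le).map_mem hs
  refine ⟨?_, ?_, ?_⟩
  · rintro ⟨_, m, hm, rfl⟩
    change IsUnit (HomogeneousLocalization.Away.map _ _ _)
    rw [key]
    exact (IsLocalization.map_units S ⟨m, hm⟩).map _
  · intro z
    obtain ⟨k, b, hb, rfl⟩ := HomogeneousLocalization.Away.mk_surjective _ hs' z
    have hb1 : b.1.coeff (k • n) ∈ (I ^ (k • n)).map (algebraMap R S) := by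
      rw [Ideal.map_pow, h]
      exact b.2 _
    obtain ⟨⟨⟨a, ha⟩, m⟩, hm⟩ := (IsLocalization.mem_map_algebraMap_iff M S).mp hb1
    refine ⟨⟨.mk _ hs k (reesMonomial I (k • n) a ha) (reesMonomial_mem _ _ _ _),
      ⟨_, m.1, m.2, rfl⟩⟩, ?_⟩
    change _ * HomogeneousLocalization.Away.map _ _ _ = HomogeneousLocalization.Away.map _ _ _
    rw [key, HomogeneousLocalization.Away.map_mk]
    apply HomogeneousLocalization.val_injective
    rw [HomogeneousLocalization.val_mul, toAway_val, HomogeneousLocalization.Away.val_mk,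
      HomogeneousLocalization.Away.val_mk, ← Localization.mk_one_eq_algebraMap,
      Localization.mk_mul, mul_one]
    congr 1
    apply Subtype.ext
    rw [reesMap_val]
    change b.1 * C (algebraMap R S m) = Polynomial.map _ (monomial _ a)
    rw [mem_reesGrading_iff.mp hb, monomial_mul_C, map_monomial, hm]
  · intro x y hxy
    obtain ⟨k, a, ha, rfl⟩ := HomogeneousLocalization.Away.mk_surjective _ hs x
    obtain ⟨l, b, hb, rfl⟩ := HomogeneousLocalization.Away.mk_surjective _ hs y
    change HomogeneousLocalization.Away.map _ _ _ = HomogeneousLocalization.Away.map _ _ _ at hxy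
    rw [HomogeneousLocalization.Away.map_mk, HomogeneousLocalization.Away.map_mk,
      HomogeneousLocalization.ext_iff_val, HomogeneousLocalization.Away.val_mk,
      HomogeneousLocalization.Away.val_mk, Localization.mk_eq_mk_iff, Localization.r_iff_exists]
      at hxy
    obtain ⟨⟨_, e, rfl⟩, he⟩ := hxy
    have he' : (s ^ e * (s ^ l * a)).1.map (algebraMap R S) =
        (s ^ e * (s ^ k * b)).1.map (algebraMap R S) := by
      rw [← reesMap_val I _ h.le, ← reesMap_val I _ h.le]
      simpa using congr($(he).1)
    let : Algebra R[X] S[X] := (mapRingHom (algebraMap R S)).toAlgebra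
    have := Polynomial.isLocalization M S
    obtain ⟨⟨_, m, hm, rfl⟩, hc⟩ := IsLocalization.exists_of_eq (M := M.map C) (S := S[X]) he'
    refine ⟨⟨_, m, hm, rfl⟩, ?_⟩
    apply HomogeneousLocalization.val_injective
    change (toAway I s m * _).val = (toAway I s m * _).val
    rw [HomogeneousLocalization.val_mul, HomogeneousLocalization.val_mul, toAway_val,
      HomogeneousLocalization.Away.val_mk, HomogeneousLocalization.Away.val_mk,
      ← Localization.mk_one_eq_algebraMap, Localization.mk_mul, Localization.mk_mul,
      Localization.mk_eq_mk_iff, Localization.r_iff_exists]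
    refine ⟨⟨_, e, rfl⟩, ?_⟩
    apply Subtype.ext
    have hc' : C m * (s.1 ^ e * (s.1 ^ l * a.1)) = C m * (s.1 ^ e * (s.1 ^ k * b.1)) := hc
    change s.1 ^ e * ((1 * s.1 ^ l) * (C m * a.1)) = s.1 ^ e * ((1 * s.1 ^ k) * (C m * b.1))
    linear_combination hc'

lemma isPullback_affineBlowup (M : Submonoid R) [Algebra R S] [IsLocalization M S]
    (h : I.map (algebraMap R S) = J) :
    IsPullback (affineBlowupMap I (algebraMap R S) h) (affineBlowupπ J) (affineBlowupπ I)
      (Spec.map (CommRingCat.ofHom (algebraMap R S))) := by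
  refine Scheme.isPullback_of_openCover _ _ _ _ (Proj.affineOpenCover (reesGrading I)).openCover
    fun (s : (i : ℕ+) × reesGrading I i) ↦ ?_
  have hn : 0 < (s.1 : ℕ) := s.1.2
  have hs : s.2.1 ∈ reesGrading I s.1 := s.2.2
  let f := reesMap I (algebraMap R S) h.le
  have hs' : f s.2.1 ∈ reesGrading J s.1 := f.map_mem hs
  have h1 : IsPullback (Proj.awayι (reesGrading J) (f s.2.1) hs' hn)
      (Spec.map (CommRingCat.ofHom (HomogeneousLocalization.Away.map f s.2.1)))
      (affineBlowupMap I (algebraMap R S) h) (Proj.awayι (reesGrading I) s.2.1 hs hn) := by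
    refine (IsOpenImmersion.isPullback _ _ _ _ ?_ ?_).flip
    · exact Proj.awayι_comp_map f _ hn s.2.1 hs
    · rw [Proj.opensRange_awayι, Proj.opensRange_awayι]
      rfl
  have h2 : IsPullback (Spec.map (CommRingCat.ofHom (HomogeneousLocalization.Away.map f s.2.1)))
      (Spec.map (CommRingCat.ofHom (toAway J (f s.2.1))))
      (Spec.map (CommRingCat.ofHom (toAway I s.2.1)))
      (Spec.map (CommRingCat.ofHom (algebraMap R S))) := by
    exact isPullback_SpecMap_of_isPushout _ _ _ _ (isPushout_of_isLocalization M _ _ _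
      (away_map_comp_toAway I (algebraMap R S) h s.2.1) (isLocalization_away I M h s.2.1 hs))
  refine h2.of_iso h1.isoPullback (Iso.refl _) (Iso.refl _) (Iso.refl _) ?_ ?_ ?_ ?_
  · exact (Category.comp_id _).trans h1.isoPullback_hom_snd.symm
  · refine (Category.comp_id _).trans ?_
    refine Eq.trans (awayι_affineBlowupπ J hn (f s.2.1) hs').symm ?_
    exact (congr($(h1.isoPullback_hom_fst) ≫ affineBlowupπ J)).symm.trans (Category.assoc _ _ _)
  · refine (Category.comp_id _).trans ?_
    refine Eq.trans (awayι_affineBlowupπ I hn s.2.1 hs).symm ?_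
    exact (Category.id_comp _).symm
  · simp

lemma isPullback_affineBlowup' (M : Submonoid R) (φ : R →+* S)
    (hφ : letI := φ.toAlgebra; IsLocalization M S) (h : I.map φ = J) :
    IsPullback (affineBlowupMap I φ h) (affineBlowupπ J) (affineBlowupπ I)
      (Spec.map (CommRingCat.ofHom φ)) := by
  let := φ.toAlgebra
  exact isPullback_affineBlowup I M h

end Affine

section Global

variable {X : Scheme.{u}} (I : X.IdealSheafData)

/-- The schemes `Proj Γ(U, 𝒪)[I(U) t]` for `U` affine open in `X`, with transition maps for
basic open subsets. -/
noncomputable def blowupFunctor : X.AffineZariskiSite ⥤ Scheme.{u} where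
  obj U := affineBlowup (I.ideal ⟨U.1, U.2⟩)
  map {U V} f := affineBlowupMap (I.ideal ⟨V.1, V.2⟩)
    (X.presheaf.map (homOfLE (Scheme.AffineZariskiSite.toOpens_mono f.le)).op).hom
    (I.map_ideal (U := ⟨U.1, U.2⟩) (V := ⟨V.1, V.2⟩) (Scheme.AffineZariskiSite.toOpens_mono f.le))
  map_id U := by
    have e : (X.presheaf.map (homOfLE (le_refl U.1)).op).hom = RingHom.id _ :=
      congr($(X.presheaf.map_id (.op U.1)).hom)
    refine Eq.trans ?_ (affineBlowupMap_id _ (Ideal.map_id _))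
    congr 1
  map_comp {U V W} f g := by
    have e : (X.presheaf.map (homOfLE (Scheme.AffineZariskiSite.toOpens_mono (f ≫ g).le)).op).hom =
        (X.presheaf.map (homOfLE (Scheme.AffineZariskiSite.toOpens_mono f.le)).op).hom.comp
          (X.presheaf.map (homOfLE (Scheme.AffineZariskiSite.toOpens_mono g.le)).op).hom :=
      congr($(X.presheaf.map_comp
        (homOfLE (Scheme.AffineZariskiSite.toOpens_mono g.le)).op
        (homOfLE (Scheme.AffineZariskiSite.toOpens_mono f.le)).op).hom)
    refine Eq.trans ?_ (affineBlowupMap_comp _ _ _ _ _ ?_)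
    · congr 1
    · rw [← e]
      exact I.map_ideal (U := ⟨U.1, U.2⟩) (V := ⟨W.1, W.2⟩) _

/-- The structure maps of the schemes `Proj Γ(U, 𝒪)[I(U) t]` over `Spec Γ(U, 𝒪)`. -/
noncomputable def blowupFunctorπ : blowupFunctor I ⟶
    Scheme.AffineZariskiSite.toOpensFunctor X ⋙ X.presheaf.rightOp ⋙ Scheme.Spec where
  app U := affineBlowupπ (I.ideal ⟨U.1, U.2⟩)
  naturality {U V} f := affineBlowupMap_π _ _
    (I.map_ideal (U := ⟨U.1, U.2⟩) (V := ⟨V.1, V.2⟩) (Scheme.AffineZariskiSite.toOpens_mono f.le))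

lemma equifibered_blowupFunctorπ : (blowupFunctorπ I).Equifibered := by
  rintro ⟨U, hU⟩ V f
  obtain ⟨g, hg⟩ := f.le
  obtain rfl : X.basicOpen g = U := hg
  exact isPullback_affineBlowup' (I.ideal ⟨V.1, V.2⟩) (.powers g)
    (X.presheaf.map (homOfLE (X.basicOpen_le g)).op).hom
    (V.2.isLocalization_basicOpen g)
    (I.map_ideal (U := ⟨X.basicOpen g, hU⟩) (V := ⟨V.1, V.2⟩) (X.basicOpen_le g))

lemma equifibered_restrictIsoSpec_inv :
    (Scheme.AffineZariskiSite.restrictIsoSpec X).inv.Equifibered := .of_isIso _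

/-- The gluing data for the relative `Proj` of the Rees algebra of `I`. -/
noncomputable def blowupGluingData :
    (Scheme.AffineZariskiSite.directedCover X).RelativeGluingData where
  functor := blowupFunctor I
  natTrans := blowupFunctorπ I ≫ (Scheme.AffineZariskiSite.restrictIsoSpec X).inv
  equifibered := (equifibered_blowupFunctorπ I).comp equifibered_restrictIsoSpec_inv

/-- The blow-up `B_Z X` of a scheme `X` along the closed subscheme `Z` with ideal sheaf `I`,
i.e. the relative `Proj` of the Rees algebra `⨁ₙ Iⁿ`. -/
noncomputable def blowup : Scheme.{u} := (blowupGluingData I).glued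

/-- The blow-up morphism `π : B_Z X ⟶ X`. -/
noncomputable def blowupπ : blowup I ⟶ X := (blowupGluingData I).toBase

/-- The canonical open immersion of `Proj Γ(U, 𝒪)[I(U) t]` into the blow-up, for `U` affine open. -/
noncomputable def blowupι (U : X.affineOpens) : affineBlowup (I.ideal U) ⟶ blowup I :=
  (blowupGluingData I).cover.f ⟨U.1, U.2⟩

/-- Over an affine open `U` the blow-up is `Proj Γ(U, 𝒪)[I(U) t] ⟶ Spec Γ(U, 𝒪) ≅ U`. -/
lemma isPullback_blowupι (U : X.affineOpens) :
    IsPullback (affineBlowupπ (I.ideal U) ≫ U.2.isoSpec.inv) (blowupι I U) U.1.ι (blowupπ I) := by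
  have e : (blowupGluingData I).natTrans.app ⟨U.1, U.2⟩ =
      affineBlowupπ (I.ideal U) ≫ U.2.isoSpec.inv := by
    change _ ≫ (Scheme.AffineZariskiSite.restrictIsoSpec X).inv.app _ = _
    rfl
  exact e ▸ (blowupGluingData I).isPullback_natTrans_ι_toBase ⟨U.1, U.2⟩

instance (U : X.affineOpens) : IsOpenImmersion (blowupι I U) :=
  MorphismProperty.of_isPullback (isPullback_blowupι I U) inferInstance

/-- The chart of the blow-up belonging to a section `s ∈ I(U)` over an affine open `U`: the image
of the affine open `D₊(s t) = Spec Γ(U, 𝒪)[I(U)/s]` of `Proj Γ(U, 𝒪)[I(U) t]`. -/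
noncomputable def blowupChart (U : X.affineOpens) (s : Γ(X, U.1)) (hs : s ∈ I.ideal U) :
    (blowup I).Opens :=
  blowupι I U ''ᵁ Proj.basicOpen (reesGrading (I.ideal U))
    (reesMonomial (I.ideal U) 1 s ((pow_one (I.ideal U)).symm ▸ hs))

/-- The stalk at `x` of an ideal sheaf, an ideal of `𝒪_{X,x}`. -/
noncomputable def stalkIdeal (x : X) : Ideal (X.presheaf.stalk x) :=
  ⨆ (U : X.affineOpens) (hx : x ∈ U.1), (I.ideal U).map (X.presheaf.germ U.1 x hx).hom

end Global

/-- `x` is a regular system of parameters of the regular local ring `R`: it generates the maximal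
ideal and its length is the dimension of `R`. -/
def IsRegularParameters {R : Type*} [CommRing R] [IsLocalRing R] {ι : Type*} [Fintype ι]
    (x : ι → R) : Prop :=
  IsRegularLocalRing R ∧ Ideal.span (Set.range x) = IsLocalRing.maximalIdeal R ∧
    (Fintype.card ι : WithBot ℕ∞) = ringKrullDim R

/-- At a point of the fibre over `(p)`: `p, x₁, …, xₙ` is a regular system of parameters if
`p ≠ 0`, and `x₁, …, xₙ` is one if `p = 0`. -/
def IsRegularParametersOver {R : Type*} [CommRing R] [IsLocalRing R] (p : ℕ) {n : ℕ}
    (x : Fin n → R) : Prop :=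
  if p = 0 then IsRegularParameters x
  else IsRegularParameters (Fin.cons (p : R) x : Fin (n + 1) → R)

end BlowUp

/-! Fibres. Locally the base is `k`, and `A` and `B = A / I` are smooth over `k`. Since `B` is
formally smooth, `A / I ^ n → B` has a section, so `A / I ^ n` is a quotient of `P = B[X_i : i ∈ I]
/ (X) ^ n`. Since `A` is formally smooth, this quotient map splits, and `A / I ^ n` is a retract of
the `k`-flat module `P` (`flat_quotient_pow`). For `S = A ⊗ K` the vanishing of `Tor₁(A / I ^ n, K)`
makes every `I ^ n ⊗ S → S` injective (`tensorIdealMap_injective`). A chart of the blow-up is a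
filtered union of copies of quotients of the powers `I ^ (k d)`, so tensoring it with `S` gives the
corresponding chart for `I S` (`isPushout_of_isChartFraction`). These cartesian squares glue over
the affine opens of `X` (`isPullback_blowupComapMap`). The fibre over `s` is the base change to the
residue field of `s`.

Coordinates. Let `R → L` be the local homomorphism from the local ring at `x` to the one at `x'`. It
is injective, and `L` is generated over `R` by the fractions `t = x_i / x₁` and by inverses of
units. The fractions are adjoined one at a time. With `Q ⊆ R[X]` the preimage of the maximal ideal
of `L` under `X ↦ t`, put `R' = R[X]_Q / (x₁ X - x_i)`. If the residue of `t` is algebraic, `Q` is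
strictly larger than `m R[X]`, so `R[X]_Q` has dimension at least `dim R + 1` and `R'` has dimension
at least `dim R`. Moreover `Q = m R[X] + (g)` for one `g`, and in `R'` the element `g` replaces `x_i
= x₁ X` as a generator. Thus `R'` is regular, and `g = X` is allowed when `t` vanishes at `x'`
(`exists_isRegularParameters_adjoin_div`). The last ring maps isomorphically to `L`: surjectively by
generation, injectively because it is a domain whose elements become elements of `R` after
multiplication by a unit and a power of `x₁`.

The residues are algebraic because `x'` is closed in its fibre: its prime `q` is then maximal among
the primes of the chart with the same contraction, so the residues generate a field of finite type
over the residue field of `R`, and Zariski's lemma applies (`IsChart.exists_monic`). -/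

namespace BlowUp

open IsLocalRing

/-! ### Regular systems of parameters; regular local rings are domains. -/

section RegularLocalRing

lemma exists_ringKrullDim_eq_natCast (R : Type*) [CommRing R] [IsLocalRing R]
    [IsNoetherianRing R] : ∃ k : ℕ, ringKrullDim R = k := by
  have h1 := ringKrullDim_le_spanFinrank_maximalIdeal R
  have h2 := ringKrullDim_nonneg_of_nontrivial (R := R)
  obtain ⟨a, ha⟩ := WithBot.ne_bot_iff_exists.mp (ne_bot_of_le_ne_bot (by simp) h2)
  rw [← ha] at h1 ⊢
  have h3 : a ≤ ((maximalIdeal R).spanFinrank : ℕ∞) := by exact_mod_cast h1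
  obtain ⟨k, rfl⟩ := ENat.ne_top_iff_exists.mp (ne_top_of_le_ne_top (ENat.natCast_ne_top _) h3)
  exact ⟨k, rfl⟩

lemma ringKrullDim_le_card {R : Type*} [CommRing R] [IsLocalRing R] [IsNoetherianRing R]
    {ι : Type*} [Fintype ι] (x : ι → R) (hx : Ideal.span (Set.range x) = maximalIdeal R) :
    ringKrullDim R ≤ Fintype.card ι := by
  classical
  refine (ringKrullDim_le_spanFinrank_maximalIdeal R).trans ?_
  rw [← hx]
  have h := Submodule.spanFinrank_span_le_ncard_of_finite (R := R) (Set.finite_range x)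
  have h' : (Set.range x).ncard ≤ Fintype.card ι := by
    rw [← Set.image_univ, ← Nat.card_eq_fintype_card, ← Set.ncard_univ]
    exact Set.ncard_image_le
  exact_mod_cast h.trans h'

/-- The dimension never exceeds the number of generators of the maximal ideal, so a lower bound on
the dimension is all that has to be checked. -/
lemma IsRegularParameters.of_card_le {R : Type*} [CommRing R] [IsLocalRing R] [IsNoetherianRing R]
    {ι : Type*} [Fintype ι] (x : ι → R) (hx : Ideal.span (Set.range x) = maximalIdeal R)
    (h : (Fintype.card ι : WithBot ℕ∞) ≤ ringKrullDim R) : IsRegularParameters x := by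
  have h1 := le_antisymm h (ringKrullDim_le_card x hx)
  refine ⟨.of_spanFinrank_maximalIdeal_le R ?_, hx, h1⟩
  rw [← h1, ← hx]
  have h := Submodule.spanFinrank_span_le_ncard_of_finite (R := R) (Set.finite_range x)
  have h' : (Set.range x).ncard ≤ Fintype.card ι := by
    rw [← Set.image_univ, ← Nat.card_eq_fintype_card, ← Set.ncard_univ]
    exact Set.ncard_image_le
  exact_mod_cast h.trans h'

lemma exists_isPrime_le_ringKrullDim_quotient (R : Type*) [CommRing R] {n : ℕ}
    (h : (n : WithBot ℕ∞) ≤ ringKrullDim R) :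
    ∃ P : Ideal R, P.IsPrime ∧ (n : WithBot ℕ∞) ≤ ringKrullDim (R ⧸ P) := by
  obtain ⟨l, hl⟩ := Order.le_krullDim_iff.mp h
  refine ⟨l.head.asIdeal, l.head.2, ?_⟩
  rw [ringKrullDim_quotient, Order.le_krullDim_iff]
  refine ⟨⟨l.length, fun i ↦ ⟨l i, ?_⟩, fun i ↦ l.step i⟩, hl⟩
  exact l.head_le i

/-- Induction on `n`: for `a = x 0` the quotient `R / (a)` is a domain of dimension `n`. Take a
prime `P` with `dim R / P ≥ n + 1`. Then `a ∉ P` for dimension reasons, and `P ⊆ (a)`. Hence `P = a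
P`, so `P = 0` by Nakayama. -/
lemma isDomain_of_span_eq_maximalIdeal (n : ℕ) : ∀ (R : Type u) [CommRing R] [IsLocalRing R]
    [IsNoetherianRing R] (x : Fin n → R), Ideal.span (Set.range x) = maximalIdeal R →
    (n : WithBot ℕ∞) ≤ ringKrullDim R → IsDomain R := by
  induction n with
  | zero =>
    intro R _ _ _ x hx _
    rw [Set.range_eq_empty, Ideal.span_empty, eq_comm, ← isField_iff_maximalIdeal_eq] at hx
    exact hx.isDomain
  | succ n ih =>
    intro R _ _ _ x hx hn
    have ha : x 0 ∈ maximalIdeal R := hx ▸ Ideal.subset_span ⟨0, rfl⟩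
    set a := x 0 with ha_def
    have hnt : Nontrivial (R ⧸ Ideal.span {a}) :=
      Ideal.Quotient.nontrivial_iff.mpr (by
        rw [Ideal.ne_top_iff_exists_maximal]
        exact ⟨_, maximalIdeal.isMaximal R, (Ideal.span_singleton_le_iff_mem _).mpr ha⟩)
    have : IsLocalRing (R ⧸ Ideal.span {a}) := .of_surjective' _ Ideal.Quotient.mk_surjective
    have hgen : Ideal.span (Set.range fun i : Fin n ↦ Ideal.Quotient.mk (Ideal.span {a}) (x i.succ))
        = maximalIdeal (R ⧸ Ideal.span {a}) := by
      rw [← map_maximalIdeal_of_surjective _ (Ideal.Quotient.mk_surjective (I := Ideal.span {a})),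
        ← hx,
        Ideal.map_span]
      refine le_antisymm (Ideal.span_mono ?_) (Ideal.span_le.mpr ?_)
      · rintro _ ⟨i, rfl⟩
        exact ⟨_, ⟨_, rfl⟩, rfl⟩
      · rintro _ ⟨_, ⟨i, rfl⟩, rfl⟩
        refine Fin.cases ?_ (fun j ↦ Ideal.subset_span ⟨j, rfl⟩) i
        rw [SetLike.mem_coe, Ideal.Quotient.eq_zero_iff_mem.mpr (Ideal.mem_span_singleton_self _)]
        exact zero_mem _
    obtain ⟨k, hk⟩ := exists_ringKrullDim_eq_natCast (R ⧸ Ideal.span {a})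
    have hle := ringKrullDim_le_ringKrullDim_quotient_add_encard {a}
      (by simpa [ringJacobson_eq_maximalIdeal] using ha)
    rw [Set.encard_singleton, hk] at hle
    have hk1 : n + 1 ≤ k + 1 := by exact_mod_cast hn.trans hle
    have hk2 : k ≤ n := by
      have := ringKrullDim_le_card _ hgen
      rw [hk, Fintype.card_fin] at this
      exact_mod_cast this
    have hdom : IsDomain (R ⧸ Ideal.span {a}) := ih _ _ hgen (by
      rw [hk]; exact_mod_cast (by omega : n ≤ k))
    obtain ⟨P, hP, hPn⟩ := exists_isPrime_le_ringKrullDim_quotient R hn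
    have : IsLocalRing (R ⧸ P) := .of_surjective' _ Ideal.Quotient.mk_surjective
    have haP : a ∉ P := by
      intro h
      have := ringKrullDim_le_of_surjective (Ideal.Quotient.factor
        ((Ideal.span_singleton_le_iff_mem P).mpr h)) (Ideal.Quotient.factor_surjective _)
      rw [hk] at this
      have : n + 1 ≤ k := by exact_mod_cast hPn.trans this
      omega
    -- An element `b ∈ P` outside `(a)` is a non-zero-divisor in the domain `R / (a)`, so `dim R /
    -- (a, b) < dim R / (a)`. But `R / (a, b)` surjects onto `R / (P + (a))`, whose dimension is at
    -- least `dim R / P - 1 ≥ n`.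
    have hPa : P ≤ Ideal.span {a} := by
      intro b hb
      by_contra hba
      have hb0 : Ideal.Quotient.mk (Ideal.span {a}) b ≠ 0 := by
        rwa [Ne, Ideal.Quotient.eq_zero_iff_mem]
      have h1 := ringKrullDim_quotient_succ_le_of_nonZeroDivisor
        (mem_nonZeroDivisors_of_ne_zero hb0)
      have h2 := ringKrullDim_le_ringKrullDim_quotient_add_encard (R := R ⧸ P)
        {Ideal.Quotient.mk P a} (by
          simp only [ringJacobson_eq_maximalIdeal, Set.singleton_subset_iff,
            SetLike.mem_coe]
          rw [← map_maximalIdeal_of_surjective _ (Ideal.Quotient.mk_surjective (I := P))]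
          exact Ideal.mem_map_of_mem _ ha)
      have h3 : ringKrullDim ((R ⧸ P) ⧸ Ideal.span {Ideal.Quotient.mk P a}) ≤
          ringKrullDim ((R ⧸ Ideal.span {a}) ⧸
            Ideal.span {Ideal.Quotient.mk (Ideal.span {a}) b}) := by
        refine ringKrullDim_le_of_surjective (Ideal.Quotient.lift _ (Ideal.Quotient.lift _
          ((Ideal.Quotient.mk _).comp (Ideal.Quotient.mk P)) ?_) ?_) ?_
        · intro c hc
          obtain ⟨d, rfl⟩ := Ideal.mem_span_singleton.mp hc
          rw [RingHom.comp_apply, Ideal.Quotient.eq_zero_iff_mem, map_mul]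
          exact Ideal.mul_mem_right _ _ (Ideal.mem_span_singleton_self _)
        · intro c hc
          obtain ⟨d, rfl⟩ := Ideal.mem_span_singleton.mp hc
          rw [map_mul, Ideal.Quotient.lift_mk, RingHom.comp_apply,
            Ideal.Quotient.eq_zero_iff_mem.mpr hb, map_zero, zero_mul]
        · refine Ideal.Quotient.lift_surjective_of_surjective _ _
            (Ideal.Quotient.lift_surjective_of_surjective _ _ ?_)
          exact Ideal.Quotient.mk_surjective.comp Ideal.Quotient.mk_surjective
      rw [Set.encard_singleton] at h2
      have h4 := (hPn.trans h2).trans (add_le_add_left h3 _)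
      rw [hk] at h1
      have h5 := h4.trans h1
      have : n + 1 ≤ k := by exact_mod_cast h5
      omega
    have hPbot : P = ⊥ := by
      refine Submodule.eq_bot_of_le_smul_of_le_jacobson_bot (Ideal.span {a}) P
        (IsNoetherian.noetherian P) ?_ ?_
      · intro b hb
        obtain ⟨c, rfl⟩ := Ideal.mem_span_singleton.mp (hPa hb)
        exact Submodule.smul_mem_smul (Ideal.mem_span_singleton_self _)
          ((hP.mem_or_mem hb).resolve_left haP)
      · rw [jacobson_eq_maximalIdeal _ bot_ne_top]
        exact (Ideal.span_singleton_le_iff_mem _).mpr ha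
    subst hPbot
    exact IsDomain.of_bot_isPrime R

lemma IsRegularParameters.isDomain {R : Type u} [CommRing R] [IsLocalRing R] {ι : Type*}
    [Fintype ι] {x : ι → R} (h : IsRegularParameters x) : IsDomain R := by
  obtain ⟨h1, h2, h3⟩ := h
  let e := (Fintype.equivFin ι).symm
  exact isDomain_of_span_eq_maximalIdeal (Fintype.card ι) R (x ∘ e)
    (by rw [Set.range_comp, e.range_eq_univ, Set.image_univ, h2]) h3.le

/-- A zero parameter could be dropped, leaving fewer generators of the maximal ideal than the
dimension. -/
lemma IsRegularParameters.ne_zero {R : Type*} [CommRing R] [IsLocalRing R] {ι : Type*}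
    [Fintype ι] {x : ι → R} (h : IsRegularParameters x) (i : ι) : x i ≠ 0 := by
  classical
  obtain ⟨h1, h2, h3⟩ := h
  intro hi
  have h4 : Ideal.span (Set.range fun j : {j // j ≠ i} ↦ x j) = maximalIdeal R := by
    rw [← h2]
    refine le_antisymm (Ideal.span_mono ?_) (Ideal.span_le.mpr ?_)
    · rintro _ ⟨j, rfl⟩
      exact ⟨_, rfl⟩
    · rintro _ ⟨j, rfl⟩
      by_cases hj : j = i
      · rw [hj, hi]; exact zero_mem _
      · exact Ideal.subset_span ⟨⟨j, hj⟩, rfl⟩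
  have h5 := ringKrullDim_le_card _ h4
  rw [← h3] at h5
  have h6 : Fintype.card ι ≤ Fintype.card {j // j ≠ i} := by exact_mod_cast h5
  have h7 := Fintype.card_pos_iff.mpr ⟨i⟩
  rw [Fintype.card_subtype_compl, Fintype.card_subtype_eq] at h6
  omega

end RegularLocalRing

end BlowUp

namespace BlowUp

open IsLocalRing Polynomial

/-! ### Adjoining fractions of parameters to a regular local ring. -/

section Chart

lemma natCast_le_of_succ_le_add_one {n : ℕ} {a : WithBot ℕ∞}
    (h : ((n + 1 : ℕ) : WithBot ℕ∞) ≤ a + 1) : (n : WithBot ℕ∞) ≤ a := by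
  induction a with
  | bot => simp at h
  | coe a =>
    have h' : ((n + 1 : ℕ) : ℕ∞) ≤ a + 1 := by exact_mod_cast h
    have : (n : ℕ∞) ≤ a := by
      push_cast at h'
      exact (ENat.add_le_add_iff_right (by simp)).mp h'
    exact_mod_cast this

/-- The preimage `Q` of the maximal ideal of `L` contracts to the maximal ideal `m` of `R`, as `φ`
is local. It contains the monic `F`, which is not in `m R[X]`. Modulo `m` one is in a polynomial
ring over a field, where `Q` becomes principal; if `t` lies in the maximal ideal, then `X ∈ Q` is a
generator. -/
lemma exists_generator_of_monic_mem {R L : Type u} [CommRing R] [IsLocalRing R] [CommRing L]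
    [IsLocalRing L] (φ : R →+* L) [IsLocalHom φ] (t : L)
    (ht : ∃ F : R[X], F.Monic ∧ F.eval₂ φ t ∈ maximalIdeal L) :
    (maximalIdeal R).map C < (maximalIdeal L).comap (eval₂RingHom φ t) ∧
    ∃ g : R[X], (maximalIdeal L).comap (eval₂RingHom φ t) =
      (maximalIdeal R).map C ⊔ Ideal.span {g} ∧ (t ∈ maximalIdeal L → g = X) := by
  set Q := (maximalIdeal L).comap (eval₂RingHom φ t) with hQ
  have hC : Q.comap C = maximalIdeal R := by
    ext a
    rw [hQ, Ideal.mem_comap, Ideal.mem_comap, coe_eval₂RingHom, eval₂_C]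
    exact (map_mem_nonunits_iff φ a)
  have hle : (maximalIdeal R).map C ≤ Q := hC ▸ Ideal.map_comap_le
  have hne : Q ≠ (Q.comap C).map C := by
    obtain ⟨F, hF, hF'⟩ := ht
    intro h
    have h1 : F ∈ (maximalIdeal R).map C := by
      rw [← hC, ← h]; exact hF'
    have h2 := Ideal.mem_map_C_iff.mp h1 F.natDegree
    rw [hF.coeff_natDegree] at h2
    exact (Ideal.ne_top_iff_one _).mp (maximalIdeal.isMaximal R).ne_top h2
  refine ⟨lt_of_le_of_ne hle (by rw [← hC]; exact hne.symm), ?_⟩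
  by_cases htm : t ∈ maximalIdeal L
  · refine ⟨X, le_antisymm ?_ (sup_le hle ?_), fun _ ↦ rfl⟩
    · intro f hf
      have hX : X * f.divX ∈ Q := by
        rw [hQ, Ideal.mem_comap, map_mul]
        exact Ideal.mul_mem_right _ _ (by simpa using htm)
      have h0 : f.coeff 0 ∈ maximalIdeal R := by
        rw [← hC, Ideal.mem_comap, show C (f.coeff 0) = f - X * f.divX from
          eq_sub_of_add_eq' (X_mul_divX_add f)]
        exact Ideal.sub_mem _ hf hX
      rw [← X_mul_divX_add f]
      exact Ideal.add_mem _
        (Ideal.mem_sup_right (Ideal.mul_mem_right _ _ (Ideal.mem_span_singleton_self _)))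
        (Ideal.mem_sup_left (Ideal.mem_map_of_mem _ h0))
    · rw [Ideal.span_singleton_le_iff_mem, hQ, Ideal.mem_comap]
      simpa using htm
  · obtain ⟨g, -, hg⟩ := Polynomial.exists_monic_span_sup_map_eq R Q
      (hC ▸ maximalIdeal.isMaximal R) hne
    exact ⟨g, hC ▸ hg, fun h ↦ absurd h htm⟩

/-- Adjoining one fraction `x i / x i₀` to a regular local ring. -/
theorem exists_isRegularParameters_adjoin_div {ι : Type*} [Fintype ι] [DecidableEq ι]
    {R L : Type u} [CommRing R] [IsLocalRing R] [CommRing L] [IsLocalRing L] (φ : R →+* L)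
    [IsLocalHom φ] {x : ι → R} (hx : IsRegularParameters x) {i₀ i : ι} (hi : i₀ ≠ i) (t : L)
    (ht : φ (x i₀) * t = φ (x i))
    (hF : ∃ F : R[X], F.Monic ∧ F.eval₂ φ t ∈ maximalIdeal L) :
    ∃ (R' : Type u) (_ : CommRing R') (_ : IsLocalRing R') (ψ : R →+* R') (φ' : R' →+* L)
      (_ : IsLocalHom φ') (y : ι → R'), φ'.comp ψ = φ ∧ IsRegularParameters y ∧
      (∀ j ≠ i, y j = ψ (x j)) ∧ t ∈ φ'.range ∧ (t ∈ maximalIdeal L → φ' (y i) = t) ∧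
      ∀ e : R', ∃ (N : ℕ) (v : R') (a : R), IsUnit v ∧ ψ (x i₀) ^ N * v * e = ψ a := by
  obtain ⟨hlt, g, hg, hgX⟩ := exists_generator_of_monic_mem φ t hF
  set ev := eval₂RingHom φ t with hev
  set Q := (maximalIdeal L).comap ev with hQ
  have hreg := hx.1
  have hxm (j : ι) : x j ∈ maximalIdeal R := hx.2.1 ▸ Ideal.subset_span ⟨j, rfl⟩
  have hQp : Q.IsPrime := inferInstance
  obtain ⟨D, _, _, hD⟩ : ∃ (D : Type u) (_ : CommRing D) (_ : Algebra R[X] D),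
      IsLocalization.AtPrime D Q := ⟨Localization.AtPrime Q, _, _, inferInstance⟩
  have : IsLocalRing D := IsLocalization.AtPrime.isLocalRing D Q
  have : IsNoetherianRing D := IsLocalization.isNoetherianRing Q.primeCompl D inferInstance
  -- The new ring is `D / (u)` with `D = R[X]_Q`. It maps to `L` because `X ↦ t` kills `x i₀ X - x
  -- i`; no identification with a subring of a fraction field is needed.
  let u : D := algebraMap R[X] D (C (x i₀) * X - C (x i))
  have hevu : ev (C (x i₀) * X - C (x i)) = 0 := by
    simp [hev, ht]
  have hu : u ∈ maximalIdeal D := by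
    rw [← IsLocalization.AtPrime.map_eq_maximalIdeal Q D]
    refine Ideal.mem_map_of_mem _ ?_
    rw [hQ, Ideal.mem_comap, hevu]
    exact zero_mem _
  have hnt : Nontrivial (D ⧸ Ideal.span {u}) :=
    Ideal.Quotient.nontrivial_iff.mpr (by
      rw [Ideal.ne_top_iff_exists_maximal]
      exact ⟨_, maximalIdeal.isMaximal D, (Ideal.span_singleton_le_iff_mem _).mpr hu⟩)
  have hloc : IsLocalRing (D ⧸ Ideal.span {u}) := .of_surjective' _ Ideal.Quotient.mk_surjective
  let ρ : R[X] →+* D ⧸ Ideal.span {u} := (Ideal.Quotient.mk _).comp (algebraMap R[X] D)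
  have hunit (s : Q.primeCompl) : IsUnit (ev s) := by
    by_contra h
    exact s.2 ((mem_maximalIdeal _).mpr h)
  let φD : D →+* L := IsLocalization.lift hunit
  have hφD (f : R[X]) : φD (algebraMap R[X] D f) = ev f := IsLocalization.lift_eq hunit f
  let φ' : D ⧸ Ideal.span {u} →+* L := Ideal.Quotient.lift _ φD (by
    intro a ha
    obtain ⟨b, rfl⟩ := Ideal.mem_span_singleton.mp ha
    rw [map_mul, hφD, hevu, zero_mul])
  have hφ' (f : R[X]) : φ' (ρ f) = ev f := hφD f
  have hρunit (s : R[X]) (hs : s ∉ Q) : IsUnit (ρ s) :=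
    (IsLocalization.map_units D (⟨s, hs⟩ : Q.primeCompl)).map (Ideal.Quotient.mk _)
  have hfrac (e : D ⧸ Ideal.span {u}) : ∃ f s : R[X], s ∉ Q ∧ ρ s * e = ρ f := by
    obtain ⟨d, rfl⟩ := Ideal.Quotient.mk_surjective e
    obtain ⟨⟨f, s⟩, hfs⟩ := IsLocalization.surj Q.primeCompl d
    exact ⟨f, s.1, s.2, by simp only [ρ, RingHom.comp_apply]; rw [← hfs, map_mul, mul_comm]⟩
  have hlocal : IsLocalHom φ' := by
    refine ⟨fun e he ↦ ?_⟩
    obtain ⟨f, s, hs, hfs⟩ := hfrac e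
    have h1 : IsUnit (ev f) := by
      rw [← hφ', ← hfs, map_mul]
      exact ((hρunit s hs).map φ').mul he
    have h2 : f ∉ Q := fun h ↦ (mem_maximalIdeal _).mp h h1
    exact isUnit_of_mul_isUnit_right (hfs ▸ hρunit f h2)
  have hmax : maximalIdeal (D ⧸ Ideal.span {u}) = Q.map ρ := by
    rw [← map_maximalIdeal_of_surjective _ (Ideal.Quotient.mk_surjective (I := Ideal.span {u})),
      ← IsLocalization.AtPrime.map_eq_maximalIdeal Q D, Ideal.map_map]
  have hrel : ρ (C (x i)) = ρ (C (x i₀)) * ρ X := by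
    rw [← map_mul, eq_comm, ← sub_eq_zero, ← map_sub]
    exact Ideal.Quotient.eq_zero_iff_mem.mpr (Ideal.mem_span_singleton_self _)
  -- The parameter in place `i` becomes the generator `g` of `Q` modulo `m`; the image of `x i` is
  -- redundant by `hrel`.
  refine ⟨D ⧸ Ideal.span {u}, inferInstance, hloc, ρ.comp C, φ', hlocal,
    Function.update (fun j ↦ ρ (C (x j))) i (ρ g), ?_, ?_, ?_, ?_, ?_, ?_⟩
  · ext a
    simp [hφ', hev]
  · refine .of_card_le _ ?_ (natCast_le_of_succ_le_add_one ?_)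
    · rw [hmax, hg, Ideal.map_sup, Ideal.map_map, ← hx.2.1, Ideal.map_span, Ideal.map_span,
        Set.image_singleton]
      refine le_antisymm (Ideal.span_le.mpr ?_) (sup_le (Ideal.span_le.mpr ?_) ?_)
      · rintro _ ⟨j, rfl⟩
        by_cases hj : j = i
        · subst hj
          rw [Function.update_self]
          exact Ideal.mem_sup_right (Ideal.mem_span_singleton_self _)
        · rw [Function.update_of_ne hj]
          exact Ideal.mem_sup_left (Ideal.subset_span ⟨_, ⟨j, rfl⟩, rfl⟩)
      · have key (j : ι) (hj : j ≠ i) : ρ (C (x j)) ∈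
            Ideal.span (Set.range (Function.update (fun j ↦ ρ (C (x j))) i (ρ g))) :=
          Ideal.subset_span ⟨j, by rw [Function.update_of_ne hj]⟩
        rintro _ ⟨_, ⟨j, rfl⟩, rfl⟩
        by_cases hj : j = i
        · subst hj
          rw [SetLike.mem_coe, show (ρ.comp C) (x j) = _ from hrel]
          exact Ideal.mul_mem_right _ _ (key _ hi)
        · exact key j hj
      · rw [Ideal.span_singleton_le_iff_mem]
        exact Ideal.subset_span ⟨i, by rw [Function.update_self]⟩
    -- `dim D` is the height of `Q`, which exceeds the height of `m R[X]`, that is `dim R`; dividing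
    -- by `u` costs at most one dimension.
    · have h1 := ringKrullDim_le_ringKrullDim_quotient_add_encard {u}
        (by simpa [ringJacobson_eq_maximalIdeal] using hu)
      rw [Set.encard_singleton] at h1
      refine le_trans ?_ h1
      rw [IsLocalization.AtPrime.ringKrullDim_eq_height Q D]
      have h2 := Ideal.height_add_one_le_of_lt_of_isPrime hlt
      rw [Polynomial.height_map_C] at h2
      refine le_trans ?_ (WithBot.coe_le_coe.mpr h2)
      rw [WithBot.coe_add, maximalIdeal_height_eq_ringKrullDim, ← hx.2.2]
      push_cast
      rfl
  · intro j hj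
    rw [Function.update_of_ne hj]
    rfl
  · exact ⟨ρ X, by rw [hφ', hev, coe_eval₂RingHom, eval₂_X]⟩
  · intro htm
    rw [Function.update_self, hφ', hgX htm, hev, coe_eval₂RingHom, eval₂_X]
  · intro e
    obtain ⟨f, s, hs, hfs⟩ := hfrac e
    -- A power of `x i₀` clears the denominators of a polynomial in `X = x i / x i₀`.
    have key (f : R[X]) : ∃ (N : ℕ) (a : R), ρ (C (x i₀)) ^ N * ρ f = ρ (C a) := by
      induction f using Polynomial.induction_on' with
      | add p q hp hq =>
        obtain ⟨N, a, ha⟩ := hp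
        obtain ⟨M, b, hb⟩ := hq
        refine ⟨N + M, x i₀ ^ M * a + x i₀ ^ N * b, ?_⟩
        simp only [map_add, map_mul, map_pow, ← ha, ← hb]
        ring
      | monomial n a =>
        refine ⟨n, a * x i ^ n, ?_⟩
        rw [← C_mul_X_pow_eq_monomial]
        simp only [map_mul, map_pow, hrel]
        ring
    obtain ⟨N, a, ha⟩ := key f
    exact ⟨N, ρ s, a, hρunit s hs, by rw [mul_assoc, hfs]; exact ha⟩

/-- Adjoining finitely many fractions `x i / x i₀` to a regular local ring. -/
theorem exists_isRegularParameters_adjoin_divs {ι : Type*} [Fintype ι] [DecidableEq ι]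
    {L : Type u} [CommRing L] [IsLocalRing L] (i₀ : ι) (T : ι → L) (s : Finset ι) :
    ∀ {R : Type u} [CommRing R] [IsLocalRing R] (φ : R →+* L) [IsLocalHom φ] {x : ι → R},
    IsRegularParameters x → (∀ i ∈ s, i₀ ≠ i) → (∀ i ∈ s, φ (x i₀) * T i = φ (x i)) →
    (∀ i ∈ s, ∃ F : R[X], F.Monic ∧ F.eval₂ φ (T i) ∈ maximalIdeal L) →
    ∃ (R' : Type u) (_ : CommRing R') (_ : IsLocalRing R') (ψ : R →+* R') (φ' : R' →+* L)
      (_ : IsLocalHom φ') (y : ι → R'), φ'.comp ψ = φ ∧ IsRegularParameters y ∧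
      (∀ j ∉ s, y j = ψ (x j)) ∧ (∀ i ∈ s, T i ∈ φ'.range) ∧
      (∀ i ∈ s, T i ∈ maximalIdeal L → φ' (y i) = T i) ∧
      ∀ e : R', ∃ (N : ℕ) (v : R') (a : R), IsUnit v ∧ ψ (x i₀) ^ N * v * e = ψ a := by
  induction s using Finset.induction_on with
  | empty =>
    intro R _ _ φ _ x hx _ _ _
    exact ⟨R, inferInstance, inferInstance, .id R, φ, inferInstance, x, by simp, hx, by simp,
      by simp, by simp, fun e ↦ ⟨0, 1, e, isUnit_one, by simp⟩⟩
  | insert i s his ih =>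
    intro R _ _ φ _ x hx h0 hT hF
    obtain ⟨R₁, _, _, ψ₁, φ₁, _, y₁, hcomp, hy₁, hne, hr, ht, hfrac⟩ :=
      exists_isRegularParameters_adjoin_div φ hx (h0 i (by simp)) (T i) (hT i (by simp))
        (hF i (by simp))
    have hφ (a : R) : φ₁ (ψ₁ a) = φ a := by rw [← hcomp]; rfl
    have hi (j : ι) (hj : j ∈ s) : j ≠ i := fun h ↦ his (h ▸ hj)
    obtain ⟨R₂, _, _, ψ₂, φ₂, _, y₂, hcomp₂, hy₂, hne₂, hr₂, ht₂, hfrac₂⟩ :=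
      ih φ₁ hy₁ (fun j hj ↦ h0 j (by simp [hj]))
        (fun j hj ↦ by
          rw [hne i₀ (h0 i (by simp)), hne j (hi j hj), hφ, hφ]
          exact hT j (by simp [hj]))
        (fun j hj ↦ by
          obtain ⟨F, hF1, hF2⟩ := hF j (by simp [hj])
          exact ⟨F.map ψ₁, hF1.map _, by rwa [eval₂_map, hcomp]⟩)
    have hφ₂ (a : R₁) : φ₂ (ψ₂ a) = φ₁ a := by rw [← hcomp₂]; rfl
    refine ⟨R₂, inferInstance, inferInstance, ψ₂.comp ψ₁, φ₂, inferInstance, y₂, ?_, hy₂, ?_, ?_,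
      ?_, ?_⟩
    · rw [← RingHom.comp_assoc, hcomp₂, hcomp]
    · intro j hj
      rw [Finset.mem_insert, not_or] at hj
      rw [hne₂ j hj.2, hne j hj.1]
      rfl
    · intro j hj
      rcases Finset.mem_insert.mp hj with rfl | hj
      · obtain ⟨a, ha⟩ := hr
        exact ⟨ψ₂ a, by rw [hφ₂, ha]⟩
      · exact hr₂ j hj
    · intro j hj htm
      rcases Finset.mem_insert.mp hj with rfl | hj
      · rw [hne₂ j his, hφ₂, ht htm]
      · exact ht₂ j hj htm
    · intro e
      obtain ⟨N, v, a, hv, hva⟩ := hfrac₂ e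
      obtain ⟨M, w, b, hw, hwb⟩ := hfrac a
      refine ⟨N + M, v * ψ₂ w, b, hv.mul (hw.map ψ₂), ?_⟩
      rw [RingHom.comp_apply ψ₂ ψ₁ b, ← hwb, map_mul, map_mul, ← hva, map_pow,
        hne i₀ (h0 i (by simp)), RingHom.comp_apply]
      ring

lemma IsRegularParameters.map_bijective {R S : Type*} [CommRing R] [IsLocalRing R] [CommRing S]
    [IsLocalRing S] {ι : Type*} [Fintype ι] {x : ι → R} (hx : IsRegularParameters x)
    (f : R →+* S) (hf : Function.Bijective f) : IsRegularParameters (f ∘ x) := by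
  obtain ⟨h1, h2, h3⟩ := hx
  let e := RingEquiv.ofBijective f hf
  refine ⟨.of_ringEquiv e, ?_, by rw [h3, ringKrullDim_eq_of_ringEquiv e]⟩
  rw [← map_maximalIdeal_of_surjective f hf.2, ← h2, Ideal.map_span, Set.range_comp]

/-- If a local ring `L` over a regular local ring `R` is generated by fractions `x i / x i₀`
of regular parameters and by inverses, then `L` is regular, with explicit parameters. -/
theorem exists_isRegularParameters_of_generated {ι : Type*} [Fintype ι] [DecidableEq ι]
    {R L : Type u} [CommRing R] [IsLocalRing R] [CommRing L] [IsLocalRing L] (φ : R →+* L)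
    [IsLocalHom φ] (hφ : Function.Injective φ) {x : ι → R} (hx : IsRegularParameters x) (i₀ : ι)
    (T : ι → L) (s : Finset ι) (h0 : ∀ i ∈ s, i₀ ≠ i) (hT : ∀ i ∈ s, φ (x i₀) * T i = φ (x i))
    (hF : ∀ i ∈ s, ∃ F : R[X], F.Monic ∧ F.eval₂ φ (T i) ∈ maximalIdeal L)
    (hgen : ∀ S : Subring L, (∀ a, φ a ∈ S) → (∀ i ∈ s, T i ∈ S) →
      (∀ a ∈ S, IsUnit a → ∃ b ∈ S, a * b = 1) → S = ⊤) :
    ∃ y : ι → L, IsRegularParameters y ∧ (∀ j ∉ s, y j = φ (x j)) ∧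
      ∀ i ∈ s, T i ∈ maximalIdeal L → y i = T i := by
  obtain ⟨R', _, _, ψ, φ', _, y, hcomp, hy, hne, hr, ht, hfrac⟩ :=
    exists_isRegularParameters_adjoin_divs i₀ T s φ hx h0 hT hF
  have hφ' (a : R) : φ' (ψ a) = φ a := by rw [← hcomp]; rfl
  have hdom := hy.isDomain
  -- The range contains the generators, and it is closed under inverses because `φ'` is local.
  have hsurj : Function.Surjective φ' := by
    rw [← RingHom.range_eq_top]
    refine hgen _ (fun a ↦ ⟨ψ a, hφ' a⟩) hr ?_
    rintro _ ⟨a, rfl⟩ ha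
    obtain ⟨b, hb⟩ := (isUnit_of_map_unit φ' a ha).exists_right_inv
    exact ⟨φ' b, ⟨b, rfl⟩, by rw [← map_mul, hb, map_one]⟩
  -- If `e` dies in `L`, then `x i₀ ^ N * v * e` comes from some `a : R` with `φ a = 0`, so `a = 0`;
  -- and `x i₀ ^ N * v ≠ 0` in the domain `R'`.
  have hinj : Function.Injective φ' := by
    rw [injective_iff_map_eq_zero]
    intro e he
    obtain ⟨N, v, a, hv, hva⟩ := hfrac e
    have ha : a = 0 := by
      apply hφ
      rw [← hφ', ← hva, map_mul, he, mul_zero, map_zero]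
    rw [ha, map_zero, ← hne i₀ (fun h ↦ h0 i₀ h rfl)] at hva
    exact (mul_eq_zero.mp hva).resolve_left
      (mul_ne_zero (pow_ne_zero _ (hy.ne_zero i₀)) hv.ne_zero)
  refine ⟨φ' ∘ y, hy.map_bijective φ' ⟨hinj, hsurj⟩, ?_, ht⟩
  intro j hj
  rw [Function.comp_apply, hne j hj, hφ']

end Chart

end BlowUp

namespace BlowUp

open IsLocalRing Polynomial

/-! ### Calculus of fractions in the chart rings of the Rees algebra. -/

section ChartFrac

variable {A : Type u} [CommRing A] {I : Ideal A} {d : ℕ} {c : A} (hc : c ∈ I ^ d)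

/-- The element `a t ^ (k d) / (c t ^ d) ^ k` of the chart ring. -/
noncomputable def chartFrac (k : ℕ) (a : A) (ha : a ∈ I ^ (k • d)) :
    HomogeneousLocalization.Away (reesGrading I) (reesMonomial I d c hc) :=
  .mk _ (reesMonomial_mem I d c hc) k (reesMonomial I (k • d) a ha) (reesMonomial_mem I _ a ha)

lemma chartFrac_surjective
    (z : HomogeneousLocalization.Away (reesGrading I) (reesMonomial I d c hc)) :
    ∃ k a ha, chartFrac hc k a ha = z := by
  obtain ⟨k, b, hb, rfl⟩ :=
    HomogeneousLocalization.Away.mk_surjective _ (reesMonomial_mem I d c hc) z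
  refine ⟨k, b.1.coeff (k • d), b.2 _, ?_⟩
  apply HomogeneousLocalization.val_injective
  rw [chartFrac, HomogeneousLocalization.Away.val_mk, HomogeneousLocalization.Away.val_mk]
  rw [← eq_reesMonomial hb]

lemma val_chartFrac (k : ℕ) (a : A) (ha : a ∈ I ^ (k • d)) :
    (chartFrac hc k a ha).val =
      Localization.mk (reesMonomial I (k • d) a ha)
        (⟨reesMonomial I d c hc ^ k, k, rfl⟩ : Submonoid.powers (reesMonomial I d c hc)) := rfl

lemma reesMonomial_pow_val (k : ℕ) :
    (reesMonomial I d c hc ^ k).1 = monomial (d * k) (c ^ k) := by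
  change (monomial d c) ^ k = _
  rw [monomial_pow]

/-- After cross-multiplication both sides are monomials of the same degree, so equality in the Rees
algebra is equality of coefficients in `A`. -/
lemma chartFrac_eq_iff (k l : ℕ) (a b : A) (ha : a ∈ I ^ (k • d)) (hb : b ∈ I ^ (l • d)) :
    chartFrac hc k a ha = chartFrac hc l b hb ↔
      ∃ N, c ^ N * (c ^ l * a) = c ^ N * (c ^ k * b) := by
  rw [HomogeneousLocalization.ext_iff_val, val_chartFrac, val_chartFrac,
    Localization.mk_eq_mk_iff, Localization.r_iff_exists]
  have key (N k l : ℕ) (a : A) (ha : a ∈ I ^ (k • d)) :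
      (reesMonomial I d c hc ^ N * (reesMonomial I d c hc ^ l * reesMonomial I (k • d) a ha)).1 =
      monomial (d * N + (d * l + k • d)) (c ^ N * (c ^ l * a)) := by
    change (reesMonomial I d c hc ^ N).1 * ((reesMonomial I d c hc ^ l).1 * monomial (k • d) a) = _
    rw [reesMonomial_pow_val, reesMonomial_pow_val, monomial_mul_monomial, monomial_mul_monomial]
  have hdeg (N : ℕ) : d * N + (d * l + k • d) = d * N + (d * k + l • d) := by
    simp only [smul_eq_mul]; ring
  constructor
  · rintro ⟨⟨_, N, rfl⟩, h⟩
    have h' := congr($(h).1)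
    refine ⟨N, ?_⟩
    change (reesMonomial I d c hc ^ N *
      (reesMonomial I d c hc ^ l * reesMonomial I (k • d) a ha)).1 =
      (reesMonomial I d c hc ^ N * (reesMonomial I d c hc ^ k * reesMonomial I (l • d) b hb)).1 at h'
    rw [key, key, hdeg] at h'
    exact monomial_injective _ h'
  · rintro ⟨N, h⟩
    refine ⟨⟨_, N, rfl⟩, Subtype.ext ?_⟩
    change (reesMonomial I d c hc ^ N *
      (reesMonomial I d c hc ^ l * reesMonomial I (k • d) a ha)).1 =
      (reesMonomial I d c hc ^ N * (reesMonomial I d c hc ^ k * reesMonomial I (l • d) b hb)).1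
    rw [key, key, hdeg, h]

lemma toAway_eq_chartFrac (a : A) :
    toAway I (reesMonomial I d c hc) a = chartFrac hc 0 a (by simp) := by
  apply HomogeneousLocalization.val_injective
  rw [toAway_val, val_chartFrac, ← Localization.mk_one_eq_algebraMap]
  congr 1
  · apply Subtype.ext
    change C a = monomial (0 • d) a
    rw [zero_smul, monomial_zero_left]

lemma chartFrac_mul (k l : ℕ) (a b : A) (ha : a ∈ I ^ (k • d)) (hb : b ∈ I ^ (l • d)) :
    chartFrac hc k a ha * chartFrac hc l b hb =
      chartFrac hc (k + l) (a * b) (by rw [add_smul, pow_add]; exact Ideal.mul_mem_mul ha hb) := by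
  apply HomogeneousLocalization.val_injective
  rw [HomogeneousLocalization.val_mul, val_chartFrac, val_chartFrac, val_chartFrac,
    Localization.mk_mul]
  congr 1
  · apply Subtype.ext
    change monomial (k • d) a * monomial (l • d) b = monomial ((k + l) • d) (a * b)
    rw [monomial_mul_monomial, add_smul]
  · apply Subtype.ext
    exact (pow_add _ _ _).symm

lemma chartFrac_add (k : ℕ) (a b : A) (ha : a ∈ I ^ (k • d)) (hb : b ∈ I ^ (k • d)) :
    chartFrac hc k (a + b) (add_mem ha hb) = chartFrac hc k a ha + chartFrac hc k b hb := by
  apply HomogeneousLocalization.val_injective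
  rw [HomogeneousLocalization.val_add, val_chartFrac, val_chartFrac, val_chartFrac,
    Localization.add_mk_self]
  congr 1
  apply Subtype.ext
  change monomial (k • d) (a + b) = monomial (k • d) a + monomial (k • d) b
  rw [map_add]

lemma toAway_mul_chartFrac (r : A) (k : ℕ) (a : A) (ha : a ∈ I ^ (k • d)) :
    toAway I (reesMonomial I d c hc) r * chartFrac hc k a ha =
      chartFrac hc k (r * a) (Ideal.mul_mem_left _ _ ha) := by
  rw [toAway_eq_chartFrac, chartFrac_mul, chartFrac_eq_iff]
  exact ⟨0, by rw [zero_add]⟩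

lemma toAway_pow_mul_chartFrac (k : ℕ) (a : A) (ha : a ∈ I ^ (k • d)) :
    toAway I (reesMonomial I d c hc) c ^ k * chartFrac hc k a ha =
      toAway I (reesMonomial I d c hc) a := by
  refine (congr($((map_pow (toAway I (reesMonomial I d c hc)) c k).symm) * _)).trans ?_
  rw [toAway_mul_chartFrac, toAway_eq_chartFrac, chartFrac_eq_iff]
  exact ⟨0, by simp⟩

lemma chartFrac_eq_zero_iff (k : ℕ) (a : A) (ha : a ∈ I ^ (k • d)) :
    chartFrac hc k a ha = 0 ↔ ∃ N, c ^ N * a = 0 := by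
  rw [← map_zero (toAway I (reesMonomial I d c hc)), toAway_eq_chartFrac, chartFrac_eq_iff]
  simp

lemma toAway_eq_zero_iff (a : A) :
    toAway I (reesMonomial I d c hc) a = 0 ↔ ∃ N, c ^ N * a = 0 := by
  rw [toAway_eq_chartFrac, chartFrac_eq_zero_iff]

lemma toAway_self_mul_eq_zero
    (z : HomogeneousLocalization.Away (reesGrading I) (reesMonomial I d c hc))
    (hz : toAway I (reesMonomial I d c hc) c * z = 0) : z = 0 := by
  obtain ⟨k, a, ha, rfl⟩ := chartFrac_surjective hc z
  rw [toAway_mul_chartFrac, chartFrac_eq_zero_iff] at hz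
  obtain ⟨N, hN⟩ := hz
  rw [chartFrac_eq_zero_iff]
  exact ⟨N + 1, by rw [← hN]; ring⟩

end ChartFrac

end BlowUp

namespace BlowUp

open IsLocalRing Polynomial

/-! ### The local rings of a chart. -/

section ChartLocal

/-- The properties of the coordinate ring `A[I / σ]` of a chart of a blow-up. -/
structure IsChart {A C : Type*} [CommRing A] [CommRing C] (I : Ideal A) (σ : A) (τ : A →+* C) :
    Prop where
  exists_pow_mul_eq : ∀ z : C, ∃ (k : ℕ) (a : A), a ∈ I ^ k ∧ τ σ ^ k * z = τ a
  exists_mul_eq : ∀ a ∈ I, ∃ z : C, τ σ * z = τ a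
  eq_zero_of_mul_eq_zero : ∀ z : C, τ σ * z = 0 → z = 0
  eq_zero_iff : ∀ a : A, τ a = 0 ↔ ∃ N : ℕ, σ ^ N * a = 0

lemma isChart_toAway {A : Type u} [CommRing A] (I : Ideal A) (σ : A) (hσ : σ ∈ I ^ 1) :
    IsChart I σ (toAway I (reesMonomial I 1 σ hσ)) where
  exists_pow_mul_eq z := by
    obtain ⟨k, a, ha, rfl⟩ := chartFrac_surjective hσ z
    exact ⟨k, a, by simpa using ha, toAway_pow_mul_chartFrac hσ k a ha⟩
  exists_mul_eq a ha := by
    have := toAway_pow_mul_chartFrac hσ 1 a (by simpa using ha)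
    exact ⟨_, (congr($((pow_one (toAway I (reesMonomial I 1 σ hσ) σ)).symm) * _)).trans this⟩
  eq_zero_of_mul_eq_zero := toAway_self_mul_eq_zero hσ
  eq_zero_iff := toAway_eq_zero_iff hσ

set_option linter.unusedSectionVars false

variable {A C R L : Type u} [CommRing A] [CommRing C] [CommRing R] [CommRing L]
  {I : Ideal A} {σ : A} {τ : A →+* C} (h : IsChart I σ τ) (q : Ideal C) [q.IsPrime]
  [Algebra A R] [Algebra C L] [IsLocalization.AtPrime R (q.comap τ)]
  [IsLocalization.AtPrime L q] {φ : R →+* L}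
  (hφ : ∀ a, φ (algebraMap A R a) = algebraMap C L (τ a))

include q h hφ

lemma IsChart.eq_zero_of_algebraMap_mul (l : L) (hl : φ (algebraMap A R σ) * l = 0) : l = 0 := by
  obtain ⟨⟨c, s⟩, hc⟩ := IsLocalization.surj q.primeCompl l
  have h1 : algebraMap C L (τ σ * c) = 0 := by
    rw [map_mul, ← hφ, ← hc, ← mul_assoc, hl, zero_mul]
  obtain ⟨m, hm⟩ := (IsLocalization.map_eq_zero_iff q.primeCompl L _).mp h1
  have h2 : (m : C) * c = 0 := h.eq_zero_of_mul_eq_zero _ (by rw [← hm]; ring)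
  have h3 : algebraMap C L c = 0 := (IsLocalization.map_eq_zero_iff q.primeCompl L _).mpr ⟨m, h2⟩
  rw [h3] at hc
  exact (IsLocalization.map_units L s).mul_left_eq_zero.mp hc

lemma IsChart.mem_nonZeroDivisors : φ (algebraMap A R σ) ∈ nonZeroDivisors L := by
  rw [mem_nonZeroDivisors_iff_right]
  intro l hl
  exact h.eq_zero_of_algebraMap_mul q hφ l (by rw [mul_comm, hl])

/-- On the chart every `a ∈ I` is the multiple `σ * (a / σ)` of `σ`. -/
lemma IsChart.map_ideal_eq (hσ : σ ∈ I) :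
    (I.map (algebraMap A R)).map φ = Ideal.span {φ (algebraMap A R σ)} := by
  rw [Ideal.map_map]
  refine le_antisymm (Ideal.map_le_iff_le_comap.mpr fun a ha ↦ ?_) ?_
  · obtain ⟨z, hz⟩ := h.exists_mul_eq a ha
    rw [Ideal.mem_comap, RingHom.comp_apply, hφ, hφ, ← hz, map_mul]
    exact Ideal.mul_mem_right _ _ (Ideal.mem_span_singleton_self _)
  · rw [Ideal.span_singleton_le_iff_mem]
    exact Ideal.mem_map_of_mem _ hσ

/-- If `a / s` dies in `L`, some `c ∉ q` kills `τ a`. Clearing the denominator of `c` gives `b : A`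
with `σ ^ N * b * a = 0`. In the domain `R` this forces `a = 0`, since `σ ≠ 0` and also `b ≠ 0`: if
`m * b = 0` with `τ m ∉ q`, then `τ m * c = 0`, although neither factor lies in the prime `q`. -/
lemma IsChart.injective [IsDomain R] (h0 : algebraMap A R σ ≠ 0) : Function.Injective φ := by
  rw [injective_iff_map_eq_zero]
  intro r hr
  obtain ⟨⟨a, s⟩, ha⟩ := IsLocalization.surj (q.comap τ).primeCompl r
  have h1 : algebraMap C L (τ a) = 0 := by
    rw [← hφ, ← ha, map_mul, hr, zero_mul]
  obtain ⟨⟨c, hc⟩, hca⟩ := (IsLocalization.map_eq_zero_iff q.primeCompl L _).mp h1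
  obtain ⟨k, b, -, hb⟩ := h.exists_pow_mul_eq c
  have h2 : τ (b * a) = 0 := by
    rw [map_mul, ← hb, mul_assoc]
    change τ σ ^ k * (c * τ a) = 0
    rw [hca, mul_zero]
  obtain ⟨N, hN⟩ := (h.eq_zero_iff _).mp h2
  have h3 : algebraMap A R σ ^ N * (algebraMap A R b * algebraMap A R a) = 0 := by
    rw [← map_mul, ← map_pow, ← map_mul, hN, map_zero]
  have hb0 : algebraMap A R b ≠ 0 := by
    intro hb0
    obtain ⟨⟨m, hm⟩, hmb⟩ := (IsLocalization.map_eq_zero_iff (q.comap τ).primeCompl R _).mp hb0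
    have h4 : τ m * c = 0 := by
      have key (k : ℕ) : ∀ z, τ σ ^ k * z = 0 → z = 0 := by
        induction k with
        | zero => intro z hz; simpa using hz
        | succ k ih =>
          intro z hz
          exact h.eq_zero_of_mul_eq_zero _ (ih _ (by rw [← hz]; ring))
      refine key k _ ?_
      calc τ σ ^ k * (τ m * c) = τ m * (τ σ ^ k * c) := by ring
        _ = τ (m * b) := by rw [hb, map_mul]
        _ = 0 := by rw [show m * b = 0 from hmb, map_zero]
    exact ((Ideal.IsPrime.mem_or_mem ‹q.IsPrime›
      (h4 ▸ q.zero_mem : τ m * c ∈ q)).elim hm hc)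
  have ha0 : algebraMap A R a = 0 :=
    ((mul_eq_zero.mp ((mul_eq_zero.mp h3).resolve_left (pow_ne_zero _ h0))).resolve_left hb0)
  rw [ha0] at ha
  exact (IsLocalization.map_units R s).mul_left_eq_zero.mp ha

variable {ι : Type*} {x : ι → R} {i₀ : ι} (hi₀ : x i₀ = algebraMap A R σ) {s : Set ι}
  (hI : I.map (algebraMap A R) = Ideal.span (x '' insert i₀ s)) {T : ι → L}
  (hT : ∀ i ∈ s, φ (x i₀) * T i = φ (x i))

include hi₀ hI hT

/-- An element of the chart is `a / σ ^ k` with `a ∈ I ^ k`. Over `R`, such an `a` is a combination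
of `k`-fold products of the `x i`, and each factor divided by `σ` is `1` or some `T i`. The quotient
by `σ ^ k` is unique as `σ` is a non-zero-divisor in `L`. -/
lemma IsChart.algebraMap_mem_subring (S : Subring L) (hS : ∀ a, φ a ∈ S) (hTS : ∀ i ∈ s, T i ∈ S)
    (z : C) : algebraMap C L z ∈ S := by
  have hM (k : ℕ) : ∀ a ∈ (I.map (algebraMap A R)) ^ k,
      ∃ l ∈ S, φ (algebraMap A R σ) ^ k * l = φ a := by
    have h1 : ∀ a ∈ I.map (algebraMap A R), ∃ l ∈ S, φ (algebraMap A R σ) * l = φ a := by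
      intro a ha
      rw [hI] at ha
      induction ha using Submodule.span_induction with
      | mem y hy =>
        obtain ⟨i, hi, rfl⟩ := hy
        rcases hi with rfl | hi
        · exact ⟨1, one_mem _, by rw [mul_one, hi₀]⟩
        · exact ⟨T i, hTS i hi, by rw [← hi₀, hT i hi]⟩
      | zero => exact ⟨0, zero_mem _, by simp⟩
      | add y z _ _ hy hz =>
        obtain ⟨l, hl, hly⟩ := hy
        obtain ⟨m, hm, hmz⟩ := hz
        exact ⟨l + m, add_mem hl hm, by rw [mul_add, hly, hmz, map_add]⟩
      | smul r y _ hy =>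
        obtain ⟨l, hl, hly⟩ := hy
        exact ⟨φ r * l, mul_mem (hS r) hl, by rw [smul_eq_mul, map_mul, ← hly]; ring⟩
    induction k with
    | zero => exact fun a _ ↦ ⟨φ a, hS a, by simp⟩
    | succ k ih =>
      intro a ha
      rw [pow_succ] at ha
      induction ha using Submodule.mul_induction_on' with
      | mem_mul_mem y hy z hz =>
        obtain ⟨l, hl, hly⟩ := ih y hy
        obtain ⟨m, hm, hmz⟩ := h1 z hz
        exact ⟨l * m, mul_mem hl hm, by rw [map_mul, ← hly, ← hmz]; ring⟩
      | add y _ z _ hy hz =>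
        obtain ⟨l, hl, hly⟩ := hy
        obtain ⟨m, hm, hmz⟩ := hz
        exact ⟨l + m, add_mem hl hm, by rw [mul_add, hly, hmz, map_add]⟩
  obtain ⟨k, a, ha, hz⟩ := h.exists_pow_mul_eq z
  obtain ⟨l, hl, hla⟩ := hM k (algebraMap A R a) (by
    rw [← Ideal.map_pow]; exact Ideal.mem_map_of_mem _ ha)
  have hn : φ (algebraMap A R σ) ^ k ∈ nonZeroDivisors L := pow_mem (h.mem_nonZeroDivisors q hφ) k
  have : algebraMap C L z = l := by
    refine (mul_cancel_left_mem_nonZeroDivisors hn).mp ?_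
    rw [hla, hφ, hφ, ← hz, map_mul, map_pow]
  exact this ▸ hl

lemma IsChart.subring_eq_top (S : Subring L) (hS : ∀ a, φ a ∈ S) (hTS : ∀ i ∈ s, T i ∈ S)
    (hinv : ∀ a ∈ S, IsUnit a → ∃ b ∈ S, a * b = 1) : S = ⊤ := by
  rw [eq_top_iff]
  intro l _
  have key := h.algebraMap_mem_subring q hφ hi₀ hI hT S hS hTS
  obtain ⟨⟨c, m⟩, hc⟩ := IsLocalization.surj q.primeCompl l
  obtain ⟨b, hb, hmb⟩ := hinv _ (key m) (IsLocalization.map_units L m)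
  have : l = algebraMap C L c * b := by
    rw [← hc, mul_assoc, hmb, mul_one]
  exact this ▸ mul_mem (key c) hb

/-- The residue of `T i` is algebraic over the residue field of `R`: the algebra `K₀` generated by
these residues is a field by the maximality `hq`, hence finite by Zariski's lemma. A monic equation
then lifts to `R[X]`. -/
lemma IsChart.exists_monic [IsLocalRing R] [IsLocalRing L] [IsLocalHom φ] (hs : s.Finite)
    (hq : ∀ q₁ : Ideal C, q₁.IsPrime → q ≤ q₁ → q₁.comap τ = q.comap τ → q₁ = q) (i : ι)
    (hi : i ∈ s) : ∃ F : R[X], F.Monic ∧ F.eval₂ φ (T i) ∈ maximalIdeal L := by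
  let : Algebra (ResidueField R) (ResidueField L) := (ResidueField.map φ).toAlgebra
  have halg (r : R) : algebraMap (ResidueField R) (ResidueField L) (residue R r) =
    residue L (φ r) := rfl
  let K₀ := Algebra.adjoin (ResidueField R) ((fun i ↦ residue L (T i)) '' s)
  have hmem (z : C) : residue L (algebraMap C L z) ∈ K₀ :=
    h.algebraMap_mem_subring q hφ hi₀ hI hT (K₀.toSubring.comap (residue L))
      (fun a ↦ K₀.algebraMap_mem (residue R a))
      (fun j hj ↦ Algebra.subset_adjoin ⟨j, hj, rfl⟩) z
  let g : C →+* K₀ := ((residue L).comp (algebraMap C L)).codRestrict K₀.toSubring hmem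
  have hg (z : C) : (g z : ResidueField L) = residue L (algebraMap C L z) := rfl
  have hgq (z : C) : z ∈ q ↔ g z = 0 := by
    rw [← IsLocalization.AtPrime.to_map_mem_maximal_iff L q z, ← residue_eq_zero_iff, ← hg]
    exact ZeroMemClass.coe_eq_zero
  have hgu (a : A) (ha : a ∉ q.comap τ) : IsUnit (g (τ a)) := by
    have h1 : IsUnit (residue R (algebraMap A R a)) :=
      (IsLocalization.map_units R (⟨a, ha⟩ : (q.comap τ).primeCompl)).map _
    have h2 : g (τ a) = algebraMap (ResidueField R) K₀ (residue R (algebraMap A R a)) := by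
      apply Subtype.ext
      rw [hg, ← hφ]
      rfl
    rw [h2]
    exact h1.map _
  -- `K₀` is the image of `C` with the elements of `A` outside `q` inverted. For a generator, write
  -- `x j = a / m` with `a ∈ I`; then `m * T j` is the element `a / σ` of the chart.
  have hfrac (k : K₀) : ∃ (a : A) (z : C), a ∉ q.comap τ ∧ g (τ a) * k = g z := by
    obtain ⟨k, hk⟩ := k
    suffices H : ∃ (a : A) (z : C), a ∉ q.comap τ ∧
        residue L (algebraMap C L (τ a)) * k = residue L (algebraMap C L z) by
      obtain ⟨a, z, ha, hz⟩ := H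
      exact ⟨a, z, ha, Subtype.ext hz⟩
    have hmul {a b : A} (ha : a ∉ q.comap τ) (hb : b ∉ q.comap τ) : a * b ∉ q.comap τ :=
      (q.comap τ).primeCompl.mul_mem ha hb
    induction hk using Algebra.adjoin_induction with
    | mem y hy =>
      obtain ⟨j, hj, rfl⟩ := hy
      have hxj : x j ∈ I.map (algebraMap A R) := hI ▸ Ideal.subset_span ⟨j, Or.inr hj, rfl⟩
      obtain ⟨⟨⟨a, ha⟩, m⟩, hm⟩ :=
        (IsLocalization.mem_map_algebraMap_iff (q.comap τ).primeCompl R).mp hxj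
      obtain ⟨z, hz⟩ := h.exists_mul_eq a ha
      refine ⟨m, z, m.2, ?_⟩
      rw [← map_mul]
      congr 1
      refine (mul_cancel_left_mem_nonZeroDivisors (h.mem_nonZeroDivisors q hφ)).mp ?_
      calc φ (algebraMap A R σ) * (algebraMap C L (τ m) * T j)
          = φ (x i₀) * T j * φ (algebraMap A R m) := by rw [hφ m, hi₀]; ring
        _ = φ (algebraMap A R a) := by rw [hT j hj, ← map_mul, hm]
        _ = φ (algebraMap A R σ) * algebraMap C L z := by rw [hφ, hφ, ← hz, map_mul]
    | algebraMap r =>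
      obtain ⟨r, rfl⟩ := residue_surjective r
      obtain ⟨⟨a, m⟩, hm⟩ := IsLocalization.surj (q.comap τ).primeCompl r
      refine ⟨m, τ a, m.2, ?_⟩
      rw [halg, ← map_mul, ← hφ, ← hφ, ← map_mul, ← hm, mul_comm]
    | add y z _ _ hy hz =>
      obtain ⟨a, c, ha, hc⟩ := hy
      obtain ⟨b, d, hb, hd⟩ := hz
      refine ⟨a * b, τ b * c + τ a * d, hmul ha hb, ?_⟩
      simp only [map_mul, map_add, ← hc, ← hd]
      ring
    | mul y z _ _ hy hz =>
      obtain ⟨a, c, ha, hc⟩ := hy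
      obtain ⟨b, d, hb, hd⟩ := hz
      refine ⟨a * b, c * d, hmul ha hb, ?_⟩
      simp only [map_mul, ← hc, ← hd]
      ring
  -- A maximal ideal of `K₀` pulls back to a prime of `C` that contains `q` and has the same
  -- contraction to `A`. It is therefore `q`, and by `hfrac` the maximal ideal is zero.
  have hfield : IsField K₀ := by
    rw [Ring.isField_iff_maximal_bot]
    obtain ⟨n, hn⟩ := Ideal.exists_maximal K₀
    have h1 : n.comap g = q := by
      refine hq _ inferInstance (fun z hz ↦ ?_) ?_
      · rw [Ideal.mem_comap, (hgq z).mp hz]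
        exact zero_mem _
      · ext a
        constructor
        · intro ha
          by_contra ha'
          exact hn.ne_top (Ideal.eq_top_of_isUnit_mem _ ha (hgu a ha'))
        · intro ha
          rw [Ideal.mem_comap, Ideal.mem_comap, (hgq _).mp ha]
          exact zero_mem _
    have h2 : n = ⊥ := by
      rw [eq_bot_iff]
      intro k hk
      obtain ⟨a, z, ha, hz⟩ := hfrac k
      have h3 : z ∈ q := by
        rw [← h1, Ideal.mem_comap, ← hz]
        exact Ideal.mul_mem_left _ _ hk
      rw [(hgq z).mp h3] at hz
      exact (hgu a ha).mul_right_eq_zero.mp hz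
    exact h2 ▸ hn
  let := hfield.toField
  have hft : Algebra.FiniteType (ResidueField R) K₀ :=
    (Subalgebra.fg_iff_finiteType _).mp (Subalgebra.fg_def.mpr ⟨_, hs.image _, rfl⟩)
  have hfin : Module.Finite (ResidueField R) K₀ :=
    finite_of_finite_type_of_isJacobsonRing (ResidueField R) K₀
  let t : K₀ := ⟨residue L (T i), Algebra.subset_adjoin ⟨i, hi, rfl⟩⟩
  obtain ⟨f, hf, hft⟩ := Algebra.IsIntegral.isIntegral (R := ResidueField R) t
  obtain ⟨F, hF, -, hFm⟩ := lifts_and_natDegree_eq_and_monic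
    (f := residue R) (p := f) (by
      rw [lifts_iff_coeff_lifts]
      exact fun n ↦ residue_surjective _) hf
  refine ⟨F, hFm, ?_⟩
  rw [← residue_eq_zero_iff, hom_eval₂]
  have h5 := congr(K₀.val $hft)
  rw [← hF, eval₂_map, ← AlgHom.coe_toRingHom, hom_eval₂, map_zero] at h5
  exact h5

/-- Regular parameters in a local ring of a chart of the blow-up of a regular local ring. -/
theorem IsChart.exists_isRegularParameters [Fintype ι] [IsLocalRing R] [IsLocalRing L]
    [IsLocalHom φ] (hx : IsRegularParameters x) (hs : i₀ ∉ s)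
    (hq : ∀ q₁ : Ideal C, q₁.IsPrime → q ≤ q₁ → q₁.comap τ = q.comap τ → q₁ = q) :
    ∃ y : ι → L, IsRegularParameters y ∧ (∀ j ∉ s, y j = φ (x j)) ∧
      ∀ i ∈ s, T i ∈ maximalIdeal L → y i = T i := by
  classical
  have hdom := hx.isDomain
  have := exists_isRegularParameters_of_generated φ
    (h.injective q hφ (by rw [← hi₀]; exact hx.ne_zero i₀)) hx i₀ T s.toFinite.toFinset
    (fun i hi h ↦ hs (by simpa [h] using hi)) (fun i hi ↦ hT i (by simpa using hi))
    (fun i hi ↦ h.exists_monic q hφ hi₀ hI hT s.toFinite hq i (by simpa using hi))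
    (fun S h1 h2 h3 ↦ h.subring_eq_top q hφ hi₀ hI hT S h1 (fun i hi ↦ h2 i (by simpa using hi)) h3)
  simpa using this

end ChartLocal

end BlowUp

namespace BlowUp

open IsLocalRing Polynomial

/-! ### Blow-up coordinates, with `p` among the parameters. -/

section ChartCoordinates

set_option linter.unusedSectionVars false

variable {A C R L : Type u} [CommRing A] [CommRing C] [CommRing R] [CommRing L]
  {I : Ideal A} {σ : A} {τ : A →+* C} (h : IsChart I σ τ) (q : Ideal C) [q.IsPrime]
  [Algebra A R] [Algebra C L] [IsLocalization.AtPrime R (q.comap τ)]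
  [IsLocalization.AtPrime L q] {φ : R →+* L}
  (hφ : ∀ a, φ (algebraMap A R a) = algebraMap C L (τ a)) [IsLocalRing R] [IsLocalRing L]
  [IsLocalHom φ]
  (hq : ∀ q₁ : Ideal C, q₁.IsPrime → q ≤ q₁ → q₁.comap τ = q.comap τ → q₁ = q)

include q h hφ hq

theorem IsChart.exists_isRegularParametersOver {n : ℕ} {p : ℕ} {x : Fin n → R} {i₀ : Fin n}
    (hi₀ : x i₀ = algebraMap A R σ) {s : Set (Fin n)}
    (hI : I.map (algebraMap A R) = Ideal.span (x '' insert i₀ s)) {T : Fin n → L}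
    (hT : ∀ i ∈ s, φ (x i₀) * T i = φ (x i)) (hx : IsRegularParametersOver p x) (hs : i₀ ∉ s) :
    ∃ y : Fin n → L, IsRegularParametersOver p y ∧ (∀ j ∉ s, y j = φ (x j)) ∧
      ∀ i ∈ s, T i ∈ maximalIdeal L → y i = T i := by
  by_cases hp : p = 0
  · obtain ⟨y, hy, hy1, hy2⟩ := h.exists_isRegularParameters q hφ hi₀ hI hT
      (by simpa [IsRegularParametersOver, hp] using hx) hs hq
    exact ⟨y, by simpa [IsRegularParametersOver, hp] using hy, hy1, hy2⟩
  -- The prime `p` is a further parameter in place `0` that is never divided: the index set is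
  -- shifted by `Fin.succ`, and the entry `0` of `T` in that place is a dummy.
  · obtain ⟨y, hy, hy1, hy2⟩ := h.exists_isRegularParameters q hφ (ι := Fin (n + 1))
      (x := Fin.cons (p : R) x) (i₀ := i₀.succ) hi₀ (s := Fin.succ '' s)
      (T := Fin.cons 0 T) (by
        rw [hI, ← Set.image_insert_eq, Set.image_image]
        rfl)
      (by
        rintro _ ⟨i, hi, rfl⟩
        exact hT i hi)
      (by simpa [IsRegularParametersOver, hp] using hx)
      (by rintro ⟨i, hi, hi'⟩; exact hs (Fin.succ_injective _ hi' ▸ hi)) hq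
    have h0 : y 0 = p := by
      rw [hy1 0 (by rintro ⟨i, -, hi⟩; exact Fin.succ_ne_zero i hi)]
      simp
    refine ⟨fun i ↦ y i.succ, ?_, ?_, ?_⟩
    · rw [IsRegularParametersOver, if_neg hp]
      convert! hy
      ext i
      refine Fin.cases ?_ (fun i ↦ ?_) i
      · exact h0.symm
      · rfl
    · intro j hj
      exact hy1 j.succ (by rintro ⟨i, hi, hi'⟩; exact hj (Fin.succ_injective _ hi' ▸ hi))
    · intro i hi hm
      exact hy2 i.succ ⟨i, hi, rfl⟩ hm

theorem IsChart.exists_coordinates {n r p : ℕ} (hr : 0 < r) (hrn : r ≤ n) {x : Fin n → R}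
    (hx₀ : algebraMap A R σ = x ⟨0, hr.trans_le hrn⟩) (hσ : σ ∈ I)
    (hI : I.map (algebraMap A R) = Ideal.span {a | ∃ i : Fin n, i.1 < r ∧ x i = a})
    (hx : IsRegularParametersOver p x) :
    ∃ xbar : Fin n → L,
      xbar ⟨0, hr.trans_le hrn⟩ = φ (x ⟨0, hr.trans_le hrn⟩) ∧
      (∀ i : Fin n, 0 < i.1 → i.1 < r → xbar i * φ (x ⟨0, hr.trans_le hrn⟩) = φ (x i)) ∧
      (∀ i : Fin n, r ≤ i.1 → xbar i = φ (x i)) ∧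
      (∃ y : Fin n → L, IsRegularParametersOver p y ∧
        ∀ i, xbar i ∈ maximalIdeal L → y i = xbar i) ∧
      ((∀ i, xbar i ∈ maximalIdeal L) → IsRegularParametersOver p xbar) := by
  classical
  set i₀ : Fin n := ⟨0, hr.trans_le hrn⟩ with hi₀
  let s : Set (Fin n) := {i | 0 < i.1 ∧ i.1 < r}
  have hset : x '' insert i₀ s = {a | ∃ i : Fin n, i.1 < r ∧ x i = a} := by
    ext a
    constructor
    · rintro ⟨i, rfl | hi, rfl⟩
      · exact ⟨_, hr, rfl⟩
      · exact ⟨i, hi.2, rfl⟩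
    · rintro ⟨i, hi, rfl⟩
      rcases Nat.eq_zero_or_pos i.1 with h0 | h0
      · exact ⟨i, Or.inl (Fin.ext h0), rfl⟩
      · exact ⟨i, Or.inr ⟨h0, hi⟩, rfl⟩
  have hT (i : Fin n) : ∃ t : L, i ∈ s → φ (x i₀) * t = φ (x i) := by
    by_cases hi : i ∈ s
    · have h1 : φ (x i) ∈ (I.map (algebraMap A R)).map φ :=
        Ideal.mem_map_of_mem _ (hI ▸ Ideal.subset_span ⟨i, hi.2, rfl⟩)
      rw [h.map_ideal_eq q hφ hσ, Ideal.mem_span_singleton, hx₀] at h1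
      obtain ⟨t, ht⟩ := h1
      exact ⟨t, fun _ ↦ ht.symm⟩
    · exact ⟨0, fun h ↦ absurd h hi⟩
  choose T hT using hT
  have hs : i₀ ∉ s := fun h ↦ lt_irrefl _ h.1
  obtain ⟨y, hy, hy1, hy2⟩ := h.exists_isRegularParametersOver q hφ hq hx₀.symm
    (by rw [hI, hset]) hT hx hs
  have hyx : ∀ i, (if i ∈ s then T i else φ (x i)) ∈ maximalIdeal L →
      y i = if i ∈ s then T i else φ (x i) := by
    intro i hi
    by_cases his : i ∈ s
    · rw [if_pos his] at hi ⊢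
      exact hy2 i his hi
    · rw [if_neg his]
      exact hy1 i his
  refine ⟨fun i ↦ if i ∈ s then T i else φ (x i), if_neg hs, ?_, ?_, ⟨y, hy, hyx⟩, ?_⟩
  · intro i hi hir
    have his : i ∈ s := ⟨hi, hir⟩
    simp only [if_pos his]
    rw [mul_comm, hT i his]
  · intro i hi
    exact if_neg fun his ↦ absurd his.2 (not_lt.mpr hi)
  · intro hall
    rwa [← show y = _ from funext fun i ↦ hyx i (hall i)]

end ChartCoordinates

/-! ### Stalks of ideal sheaves, and charts as affine open subschemes. -/

section Stalks

variable {X : Scheme.{u}} (I : X.IdealSheafData)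

/-- Both ideals equal the one coming from an affine neighbourhood of `x` inside `U ⊓ V`. Hence the
supremum defining `stalkIdeal` runs over equal ideals. -/
lemma map_germ_le_map_germ {x : X} (U V : X.affineOpens) (hU : x ∈ U.1) (hV : x ∈ V.1) :
    (I.ideal V).map (X.presheaf.germ V.1 x hV).hom ≤
      (I.ideal U).map (X.presheaf.germ U.1 x hU).hom := by
  obtain ⟨_, ⟨W, hW, rfl⟩, hxW, hWle⟩ := X.isBasis_affineOpens.exists_subset_of_mem_open
    (show x ∈ ((U.1 ⊓ V.1 : X.Opens) : Set X) from ⟨hU, hV⟩) (U.1 ⊓ V.1).2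
  have hWU : (⟨W, hW⟩ : X.affineOpens) ≤ U := fun y hy ↦ (hWle hy).1
  have hWV : (⟨W, hW⟩ : X.affineOpens) ≤ V := fun y hy ↦ (hWle hy).2
  have key (V : X.affineOpens) (hV : x ∈ V.1) (hWV : (⟨W, hW⟩ : X.affineOpens) ≤ V) :
      (I.ideal V).map (X.presheaf.germ V.1 x hV).hom =
        (I.ideal ⟨W, hW⟩).map (X.presheaf.germ W x hxW).hom := by
    rw [← I.map_ideal hWV, Ideal.map_map, ← CommRingCat.hom_comp]
    erw [TopCat.Presheaf.germ_res]
  rw [key V hV hWV, key U hU hWU]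

lemma stalkIdeal_eq {x : X} (U : X.affineOpens) (hU : x ∈ U.1) :
    stalkIdeal I x = (I.ideal U).map (X.presheaf.germ U.1 x hU).hom := by
  refine le_antisymm (iSup₂_le fun V hV ↦ map_germ_le_map_germ I U V hU hV) ?_
  exact le_iSup₂_of_le (f := fun (U : X.affineOpens) (hx : x ∈ U.1) ↦
    (I.ideal U).map (X.presheaf.germ U.1 x hx).hom) U hU le_rfl

/-- The open immersion of the spectrum of the coordinate ring of a chart into the blow-up. -/
noncomputable def chartι (U : X.affineOpens) (s : Γ(X, U.1)) (hs : s ∈ I.ideal U ^ 1) :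
    Spec (.of (HomogeneousLocalization.Away (reesGrading (I.ideal U))
      (reesMonomial (I.ideal U) 1 s hs))) ⟶ blowup I :=
  Proj.awayι (reesGrading (I.ideal U)) _ (reesMonomial_mem _ 1 s hs) one_pos ≫ blowupι I U

instance (U : X.affineOpens) (s : Γ(X, U.1)) (hs : s ∈ I.ideal U ^ 1) :
    IsOpenImmersion (chartι I U s hs) := by
  unfold chartι
  infer_instance

lemma chartι_blowupπ (U : X.affineOpens) (s : Γ(X, U.1)) (hs : s ∈ I.ideal U ^ 1) :
    chartι I U s hs ≫ blowupπ I =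
      Spec.map (CommRingCat.ofHom (toAway (I.ideal U) (reesMonomial (I.ideal U) 1 s hs))) ≫
        U.2.fromSpec := by
  rw [chartι, Category.assoc, ← (isPullback_blowupι I U).w, Category.assoc,
    reassoc_of% awayι_affineBlowupπ (I.ideal U) one_pos _ (reesMonomial_mem _ 1 s hs)]
  rfl

lemma range_chartι (U : X.affineOpens) (s : Γ(X, U.1)) (hs : s ∈ I.ideal U) :
    (blowupChart I U s hs : Set (blowup I)) =
      Set.range (chartι I U s ((pow_one (I.ideal U)).symm ▸ hs)) := by
  rw [blowupChart, chartι, Scheme.Hom.comp_base, TopCat.coe_comp, Set.range_comp,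
    ← Scheme.Hom.coe_opensRange, Proj.opensRange_awayι]
  rfl

end Stalks

end BlowUp

namespace BlowUp

open IsLocalRing Polynomial

lemma IsChart.of_ringEquiv {A C C' : Type*} [CommRing A] [CommRing C] [CommRing C'] {I : Ideal A}
    {σ : A} {τ : A →+* C} (h : IsChart I σ τ) (τ' : A →+* C') (e : C' ≃+* C)
    (he : ∀ a, e (τ' a) = τ a) : IsChart I σ τ' where
  exists_pow_mul_eq z := by
    obtain ⟨k, a, ha, hz⟩ := h.exists_pow_mul_eq (e z)
    exact ⟨k, a, ha, e.injective (by rw [map_mul, map_pow, he, he, hz])⟩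
  exists_mul_eq a ha := by
    obtain ⟨z, hz⟩ := h.exists_mul_eq a ha
    exact ⟨e.symm z, e.injective (by rw [map_mul, he, he, e.apply_symm_apply, hz])⟩
  eq_zero_of_mul_eq_zero z hz := by
    apply e.injective
    rw [map_zero]
    exact h.eq_zero_of_mul_eq_zero _ (by rw [← he, ← map_mul, hz, map_zero])
  eq_zero_iff a := by
    rw [← h.eq_zero_iff, ← he, map_eq_zero_iff e e.injective]

/-! ### Sections of the blow-up over a chart. -/

section Stalks

variable {X : Scheme.{u}} (I : X.IdealSheafData)

lemma fromSpec_comp_appLE {X : Scheme.{u}} {U : X.Opens} (hU : IsAffineOpen U) {C : CommRingCat.{u}}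
    (t : Γ(X, U) ⟶ C) (e : ⊤ ≤ (Spec.map t ≫ hU.fromSpec) ⁻¹ᵁ U) :
    (Spec.map t ≫ hU.fromSpec).appLE U ⊤ e ≫ (Scheme.ΓSpecIso C).hom = t := by
  have e1 : (⊤ : (Spec Γ(X, U)).Opens) ≤ hU.fromSpec ⁻¹ᵁ U := by
    rw [hU.fromSpec_preimage_self]
  have h1 : hU.fromSpec.appLE U ⊤ e1 = (Scheme.ΓSpecIso Γ(X, U)).inv := by
    rw [Scheme.Hom.appLE, hU.fromSpec_app_self, Category.assoc, ← Functor.map_comp]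
    exact (congr(_ ≫ (Spec Γ(X, U)).presheaf.map $(Subsingleton.elim _ (𝟙 _)))).trans (by simp)
  rw [← Scheme.Hom.appLE_comp_appLE (Spec.map t) hU.fromSpec U ⊤ ⊤ e1 le_top, h1, Category.assoc,
    Iso.inv_comp_eq, ← Scheme.ΓSpecIso_naturality]
  congr 1

/-- The open immersion `j` identifies `C` with the sections over its image, compatibly with the maps
from `Γ(X, U)`. This replaces the algebraic chart ring by sections of the blow-up, whose
localizations are stalks. -/
lemma IsChart.appLE {X Y : Scheme.{u}} (π : Y ⟶ X) {U : X.Opens} (hU : IsAffineOpen U)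
    {C : CommRingCat.{u}} (j : Spec C ⟶ Y) [IsOpenImmersion j] (t : Γ(X, U) ⟶ C)
    (w : j ≫ π = Spec.map t ≫ hU.fromSpec) {I : Ideal Γ(X, U)} {s : Γ(X, U)}
    (h : IsChart I s t.hom) (hle : j ''ᵁ ⊤ ≤ π ⁻¹ᵁ U) :
    IsChart I s (π.appLE U (j ''ᵁ ⊤) hle).hom := by
  refine h.of_ringEquiv _ (j.appIso ⊤ ≪≫ Scheme.ΓSpecIso C).commRingCatIsoToRingEquiv fun a ↦ ?_
  have e1 : (⊤ : (Spec C).Opens) ≤ (j ≫ π) ⁻¹ᵁ U := fun x _ ↦ hle ⟨x, trivial, rfl⟩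
  have h1 : π.appLE U _ hle ≫ (j.appIso ⊤).hom = (j ≫ π).appLE U ⊤ e1 := by
    rw [Scheme.Hom.appIso_hom', Scheme.Hom.appLE_comp_appLE]
  have h3 : π.appLE U _ hle ≫ (j.appIso ⊤ ≪≫ Scheme.ΓSpecIso C).hom = t := by
    rw [Iso.trans_hom, ← Category.assoc, h1]
    simp only [w]
    exact fromSpec_comp_appLE hU t _
  exact congr($(h3).hom a)

lemma blowupChart_eq_image (U : X.affineOpens) (s : Γ(X, U.1)) (hs : s ∈ I.ideal U) :
    blowupChart I U s hs = chartι I U s ((pow_one (I.ideal U)).symm ▸ hs) ''ᵁ ⊤ := by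
  apply TopologicalSpace.Opens.ext
  rw [range_chartι]
  simp

lemma isAffineOpen_blowupChart (U : X.affineOpens) (s : Γ(X, U.1)) (hs : s ∈ I.ideal U) :
    IsAffineOpen (blowupChart I U s hs) := by
  rw [blowupChart_eq_image]
  exact (isAffineOpen_top _).image_of_isOpenImmersion _

lemma blowupChart_le (U : X.affineOpens) (s : Γ(X, U.1)) (hs : s ∈ I.ideal U) :
    blowupChart I U s hs ≤ blowupπ I ⁻¹ᵁ U.1 := by
  intro y hy
  rw [← SetLike.mem_coe, range_chartι] at hy
  obtain ⟨q, rfl⟩ := hy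
  change blowupπ I (chartι I U s _ q) ∈ U.1
  rw [← Scheme.Hom.comp_apply, chartι_blowupπ, Scheme.Hom.comp_apply]
  have := Set.mem_range_self (f := U.2.fromSpec) (Spec.map (CommRingCat.ofHom
    (toAway (I.ideal U) (reesMonomial (I.ideal U) 1 s ((pow_one (I.ideal U)).symm ▸ hs)))) q)
  rwa [U.2.range_fromSpec] at this

lemma isChart_appLE (U : X.affineOpens) (s : Γ(X, U.1)) (hs : s ∈ I.ideal U) :
    IsChart (I.ideal U) s
      ((blowupπ I).appLE U.1 (blowupChart I U s hs) (blowupChart_le I U s hs)).hom := by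
  have hs' : s ∈ I.ideal U ^ 1 := (pow_one (I.ideal U)).symm ▸ hs
  have key (W : (blowup I).Opens) (hW : W = chartι I U s hs' ''ᵁ ⊤) (hle : W ≤ blowupπ I ⁻¹ᵁ U.1) :
      IsChart (I.ideal U) s ((blowupπ I).appLE U.1 W hle).hom := by
    subst hW
    exact IsChart.appLE (blowupπ I) U.2 (chartι I U s hs') _ (chartι_blowupπ I U s hs')
      (isChart_toAway (I.ideal U) s hs') hle
  exact key _ (blowupChart_eq_image I U s hs) _

end Stalks

/-! ### Coordinates at a point closed in its fibre. -/

section Main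

variable {X S : Scheme.{u}} (f : X ⟶ S) (I : X.IdealSheafData)

/-- A point closed in its fibre is maximal among the points of an affine chart in the fibre of
`π`. -/
lemma eq_of_le_of_comap_eq {Y : Scheme.{u}} (π : Y ⟶ X) (s : S) (z : (π ≫ f).fiber s)
    (hz : IsClosed {z}) {U : X.Opens} {V : Y.Opens} (hU : IsAffineOpen U) (hV : IsAffineOpen V)
    (e : V ≤ π ⁻¹ᵁ U) (q : Spec Γ(Y, V)) (hq : hV.fromSpec q = (π ≫ f).fiberι s z)
    (q₁ : Ideal Γ(Y, V)) (hq₁ : q₁.IsPrime) (hle : q.asIdeal ≤ q₁)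
    (hcomap : q₁.comap (π.appLE U V e).hom = q.asIdeal.comap (π.appLE U V e).hom) :
    q₁ = q.asIdeal := by
  let q' : Spec Γ(Y, V) := ⟨q₁, hq₁⟩
  have h1 : Spec.map (π.appLE U V e) q' = Spec.map (π.appLE U V e) q := by
    apply PrimeSpectrum.ext
    exact hcomap
  have h2 : π (hV.fromSpec q') = π (hV.fromSpec q) := by
    rw [← Scheme.Hom.comp_apply, ← Scheme.Hom.comp_apply, ← hU.SpecMap_appLE_fromSpec π hV e,
      Scheme.Hom.comp_apply, Scheme.Hom.comp_apply, h1]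
  -- Having the same image under `π`, the point `q'` lies over `s` as well. It is a specialization
  -- of `q` inside the fibre, where `z` is closed.
  have h3 : hV.fromSpec q' ∈ Set.range ((π ≫ f).fiberι s) := by
    rw [Scheme.Hom.range_fiberι, Set.mem_preimage, Set.mem_singleton_iff, Scheme.Hom.comp_apply,
      h2, ← Scheme.Hom.comp_apply, hq]
    have := Set.mem_range_self (f := (π ≫ f).fiberι s) z
    rwa [Scheme.Hom.range_fiberι] at this
  obtain ⟨z', hz'⟩ := h3
  have h4 : q ⤳ q' := (PrimeSpectrum.le_iff_specializes _ _).mp hle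
  have h5 : (π ≫ f).fiberι s z ⤳ (π ≫ f).fiberι s z' := by
    rw [← hq, hz']
    exact h4.map hV.fromSpec.continuous
  have h6 : z ⤳ z' := ((π ≫ f).fiberι s).isEmbedding.isInducing.specializes_iff.mp h5
  have h7 : z' = z := h6.mem_closed hz rfl
  have h8 : q' = q := hV.fromSpec.isOpenEmbedding.injective (by rw [← hz', h7, hq])
  exact congr($(h8).asIdeal)

theorem blowup_coordinates (s : S) (p : ℕ) (z : (blowupπ I ≫ f).fiber s) (hz : IsClosed {z})
    (x' : blowup I) (hx' : x' = (blowupπ I ≫ f).fiberι s z) (n r : ℕ) (hr : 0 < r) (hrn : r ≤ n)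
    (x : Fin n → X.presheaf.stalk (blowupπ I x')) (hx : IsRegularParametersOver p x)
    (hI : stalkIdeal I (blowupπ I x') = Ideal.span {a | ∃ i, i.1 < r ∧ x i = a})
    (U : X.affineOpens) (hU : blowupπ I x' ∈ U.1) (σ : Γ(X, U.1)) (hσ : σ ∈ I.ideal U)
    (hσx : X.presheaf.germ U.1 (blowupπ I x') hU σ = x ⟨0, hr.trans_le hrn⟩)
    (hx'U : x' ∈ blowupChart I U σ hσ) :
    ((blowupπ I).stalkMap x').hom (x ⟨0, hr.trans_le hrn⟩) ∈
      nonZeroDivisors ((blowup I).presheaf.stalk x') ∧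
    (stalkIdeal I (blowupπ I x')).map ((blowupπ I).stalkMap x').hom =
      Ideal.span {((blowupπ I).stalkMap x').hom (x ⟨0, hr.trans_le hrn⟩)} ∧
    ∃ xbar : Fin n → (blowup I).presheaf.stalk x',
      xbar ⟨0, hr.trans_le hrn⟩ = ((blowupπ I).stalkMap x').hom (x ⟨0, hr.trans_le hrn⟩) ∧
      (∀ i : Fin n, 0 < i.1 → i.1 < r →
        xbar i * ((blowupπ I).stalkMap x').hom (x ⟨0, hr.trans_le hrn⟩) =
          ((blowupπ I).stalkMap x').hom (x i)) ∧
      (∀ i : Fin n, r ≤ i.1 → xbar i = ((blowupπ I).stalkMap x').hom (x i)) ∧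
      (∃ y : Fin n → (blowup I).presheaf.stalk x', IsRegularParametersOver p y ∧
        ∀ i, xbar i ∈ maximalIdeal ((blowup I).presheaf.stalk x') → y i = xbar i) ∧
      ((∀ i, xbar i ∈ maximalIdeal ((blowup I).presheaf.stalk x')) →
        IsRegularParametersOver p xbar) := by
  set V := blowupChart I U σ hσ with hVdef
  have hV : IsAffineOpen V := isAffineOpen_blowupChart I U σ hσ
  have e : V ≤ blowupπ I ⁻¹ᵁ U.1 := blowupChart_le I U σ hσ
  let τ := ((blowupπ I).appLE U.1 V e).hom
  have hchart : IsChart (I.ideal U) σ τ := isChart_appLE I U σ hσ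
  let q := hV.primeIdealOf ⟨x', hx'U⟩
  let : Algebra Γ(X, U.1) (X.presheaf.stalk (blowupπ I x')) :=
    TopCat.Presheaf.algebra_section_stalk X.presheaf ⟨blowupπ I x', hU⟩
  let : Algebra Γ(blowup I, V) ((blowup I).presheaf.stalk x') :=
    TopCat.Presheaf.algebra_section_stalk (blowup I).presheaf ⟨x', hx'U⟩
  have hL : IsLocalization.AtPrime ((blowup I).presheaf.stalk x') q.asIdeal :=
    hV.isLocalization_stalk ⟨x', hx'U⟩
  have hcomap : q.asIdeal.comap τ = (U.2.primeIdealOf ⟨blowupπ I x', hU⟩).asIdeal :=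
    congr($(IsAffineOpen.comap_primeIdealOf_appLE U.1 U.2 V hV e hx'U).asIdeal)
  have hR : IsLocalization.AtPrime (X.presheaf.stalk (blowupπ I x')) (q.asIdeal.comap τ) := by
    have := U.2.isLocalization_stalk ⟨blowupπ I x', hU⟩
    convert! this
  have hφ (a : Γ(X, U.1)) : ((blowupπ I).stalkMap x').hom
      (algebraMap Γ(X, U.1) (X.presheaf.stalk (blowupπ I x')) a) =
      algebraMap Γ(blowup I, V) ((blowup I).presheaf.stalk x') (τ a) := by
    have h1 := Scheme.Hom.germ_stalkMap (blowupπ I) U.1 x' hU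
    have h2 : (blowupπ I).appLE U.1 V e ≫ (blowup I).presheaf.germ V x' hx'U =
        (blowupπ I).app U.1 ≫ (blowup I).presheaf.germ (blowupπ I ⁻¹ᵁ U.1) x' hU := by
      rw [Scheme.Hom.appLE, Category.assoc, TopCat.Presheaf.germ_res]
    exact congr(($(h1.trans h2.symm)).hom a)
  have hIU : stalkIdeal I (blowupπ I x') = (I.ideal U).map
      (algebraMap Γ(X, U.1) (X.presheaf.stalk (blowupπ I x'))) := stalkIdeal_eq I U hU
  have hσx' : algebraMap Γ(X, U.1) (X.presheaf.stalk (blowupπ I x')) σ =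
    x ⟨0, hr.trans_le hrn⟩ := hσx
  have hq := eq_of_le_of_comap_eq f (blowupπ I) s z hz U.2 hV e q
    ((hV.fromSpec_primeIdealOf ⟨x', hx'U⟩).trans hx')
  refine ⟨?_, ?_, hchart.exists_coordinates q.asIdeal hφ hq hr hrn hσx' hσ (hIU ▸ hI) hx⟩
  · rw [← hσx']
    exact hchart.mem_nonZeroDivisors q.asIdeal hφ
  · rw [← hσx', hIU]
    exact hchart.map_ideal_eq q.asIdeal hφ hσ

end Main

end BlowUp

namespace BlowUp

/-! ### Flatness of the infinitesimal neighbourhoods of a smooth centre. -/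

section Flat

/-- The quotient of a polynomial ring by a power of the ideal of the variables is flat. -/
lemma flat_quotient_pow_idealOfVars (σ B : Type*) [CommRing B] (n : ℕ) :
    Module.Flat B (MvPolynomial σ B ⧸ MvPolynomial.idealOfVars σ B ^ n) := by
  classical
  -- Truncation in degrees below `n` is a linear section of the quotient map, so the quotient is a
  -- retract of a free module.
  let t : MvPolynomial σ B →ₗ[B] MvPolynomial σ B := (MvPolynomial.basisMonomials σ B).constr B
    fun d ↦ if d.degree < n then MvPolynomial.monomial d 1 else 0
  let K := (MvPolynomial.idealOfVars σ B ^ n).restrictScalars B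
  have ht : K ≤ LinearMap.ker t := by
    intro p hp
    have hp' := (MvPolynomial.mem_pow_idealOfVars_iff n p).mp hp
    rw [LinearMap.mem_ker, Module.Basis.constr_apply]
    refine Finset.sum_eq_zero fun d hd ↦ ?_
    beta_reduce
    rw [if_neg (not_lt.mpr (hp' d hd)), smul_zero]
  have key : K.mkQ ∘ₗ t = K.mkQ := by
    refine (MvPolynomial.basisMonomials σ B).ext fun d ↦ ?_
    rw [LinearMap.comp_apply, Module.Basis.constr_basis]
    split_ifs with hd
    · simp
    · rw [map_zero, eq_comm]
      refine (Submodule.Quotient.mk_eq_zero _).mpr ?_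
      rw [Submodule.restrictScalars_mem, MvPolynomial.mem_pow_idealOfVars_iff']
      intro x hx
      rw [MvPolynomial.coe_basisMonomials, MvPolynomial.coeff_monomial, if_neg]
      rintro rfl
      exact hd hx
  have : Module.Flat B (MvPolynomial σ B ⧸ K) := by
    refine Module.Flat.of_retract (K.liftQ t ht) K.mkQ ?_
    refine K.linearMap_qext ?_
    rw [LinearMap.comp_assoc, Submodule.liftQ_mkQ, key, LinearMap.id_comp]
  exact Module.Flat.of_linearEquiv
    (Submodule.Quotient.restrictScalarsEquiv B (MvPolynomial.idealOfVars σ B ^ n)).symm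

/-- Successive approximation: an error in `T ^ m Q` is corrected up to `T ^ (m + 1) Q`, and `T ^ n Q
= 0`. -/
lemma surjective_of_forall_sub_mem {P Q : Type*} [CommRing P] [CommRing Q] (φ : P →+* Q)
    (T : Ideal P) (h : ∀ q, ∃ p, q - φ p ∈ T.map φ) {n : ℕ} (hn : T.map φ ^ n = ⊥) :
    Function.Surjective φ := by
  have step (m : ℕ) (q : Q) (hq : q ∈ (T ^ m).map φ) : ∃ p, q - φ p ∈ (T ^ (m + 1)).map φ := by
    induction hq using Submodule.span_induction with
    | mem x hx =>
      obtain ⟨p, -, rfl⟩ := hx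
      exact ⟨p, by simp⟩
    | zero => exact ⟨0, by simp⟩
    | add x y _ _ hx hy =>
      obtain ⟨p, hp⟩ := hx
      obtain ⟨p', hp'⟩ := hy
      refine ⟨p + p', ?_⟩
      rw [map_add, add_sub_add_comm]
      exact add_mem hp hp'
    | smul q x hx' hx =>
      obtain ⟨p, hp⟩ := hx
      obtain ⟨p', hp'⟩ := h q
      refine ⟨p' * p, ?_⟩
      have e : q • x - φ (p' * p) = (q - φ p') * x + φ p' * (x - φ p) := by
        rw [smul_eq_mul, map_mul]
        ring
      rw [e]
      refine add_mem ?_ (Ideal.mul_mem_left _ _ hp)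
      rw [pow_succ', Ideal.map_mul]
      exact Ideal.mul_mem_mul hp' hx'
  have all (m : ℕ) (q : Q) : ∃ p, q - φ p ∈ (T ^ m).map φ := by
    induction m with
    | zero => exact ⟨0, by simp [Ideal.map_top]⟩
    | succ m ih =>
      obtain ⟨p, hp⟩ := ih
      obtain ⟨p', hp'⟩ := step m _ hp
      exact ⟨p + p', by rwa [map_add, ← sub_sub]⟩
  intro q
  obtain ⟨p, hp⟩ := all n q
  rw [Ideal.map_pow, hn, Ideal.mem_bot, sub_eq_zero] at hp
  exact ⟨p, hp.symm⟩

/-- By `hTI` the kernel of `φ` lies in the nilpotent ideal `T`, so formal smoothness lifts `μ` to `τ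
: A → P`. Again by `hTI`, `τ` maps `I` into `T`, so it kills `I ^ n = ker μ` and descends to a
section of `φ`. Thus `Q` is a retract of the flat module `P`. -/
lemma flat_of_surjective {k A P Q : Type u} [CommRing k] [CommRing A] [CommRing P] [CommRing Q]
    [Algebra k A] [Algebra k P] [Algebra k Q] [Algebra.FormallySmooth k A] (μ : A →ₐ[k] Q)
    (hμ : Function.Surjective μ) (I : Ideal A) {n : ℕ} (hI : RingHom.ker μ = I ^ n)
    (φ : P →ₐ[k] Q) (hφ : Function.Surjective φ) (T : Ideal P) (hTn : T ^ n = ⊥)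
    (hTI : ∀ p, φ p ∈ I.map μ → p ∈ T) [Module.Flat k P] : Module.Flat k Q := by
  have hker : RingHom.ker (φ : P →+* Q) ^ n = ⊥ := by
    have hle : RingHom.ker (φ : P →+* Q) ≤ T := by
      intro p hp
      refine hTI p ?_
      rw [show φ p = 0 from hp]
      exact zero_mem _
    rw [eq_bot_iff, ← hTn]
    exact Ideal.pow_right_mono hle n
  let τ : A →ₐ[k] P := Algebra.FormallySmooth.liftOfSurjective μ φ hφ ⟨n, hker⟩
  have hτ (a : A) : φ (τ a) = μ a :=
    Algebra.FormallySmooth.liftOfSurjective_apply μ φ hφ ⟨n, hker⟩ a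
  have hτI : I.map τ ≤ T := by
    rw [Ideal.map_le_iff_le_comap]
    exact fun a ha ↦ hTI _ (by rw [hτ]; exact Ideal.mem_map_of_mem _ ha)
  have hτn : ∀ a, μ a = 0 → τ a = 0 := by
    intro a ha
    have h1 : τ a ∈ I.map τ ^ n := by
      rw [← Ideal.map_pow]
      exact Ideal.mem_map_of_mem _ (hI ▸ ha)
    simpa [hTn] using Ideal.pow_right_mono hτI n h1
  refine Module.Flat.of_retract ((LinearMap.ker μ.toLinearMap).liftQ τ.toLinearMap
    (fun a ha ↦ hτn a ha) ∘ₗ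
      (μ.toLinearMap.quotKerEquivOfSurjective hμ).symm.toLinearMap) φ.toLinearMap ?_
  ext q
  obtain ⟨a, rfl⟩ := hμ q
  have : (μ.toLinearMap.quotKerEquivOfSurjective hμ).symm (μ a) =
      (LinearMap.ker μ.toLinearMap).mkQ a := by
    rw [LinearEquiv.symm_apply_eq]
    rfl
  change φ ((LinearMap.ker μ.toLinearMap).liftQ τ.toLinearMap (fun a ha ↦ hτn a ha)
    ((μ.toLinearMap.quotKerEquivOfSurjective hμ).symm (μ a))) = μ a
  rw [this]
  exact hτ a

/-- If `A` and `A / I` are smooth over `k`, all infinitesimal neighbourhoods of `Spec A / I` in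
`Spec A` are flat over `k`: they are retracts of infinitesimal neighbourhoods of the zero section
of an affine space over `A / I`. -/
theorem flat_of_ker_eq_pow {k A B Q : Type u} [CommRing k] [CommRing A] [CommRing B] [CommRing Q]
    [Algebra k A] [Algebra k B] [Algebra k Q] [Algebra.FormallySmooth k A]
    [Algebra.FormallySmooth k B] [Module.Flat k B] (I : Ideal A) (n : ℕ) (μ : A →ₐ[k] Q)
    (hμ : Function.Surjective μ) (hμI : RingHom.ker μ = I ^ n) (ρ : Q →ₐ[k] B)
    (hρ : Function.Surjective ρ) (hρI : RingHom.ker (ρ : Q →+* B) = I.map μ) :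
    Module.Flat k Q := by
  let P := MvPolynomial I B
  let T : Ideal P := MvPolynomial.idealOfVars I B
  have hIn : I.map μ ^ n = ⊥ := by
    rw [eq_bot_iff, ← Ideal.map_pow, Ideal.map_le_iff_le_comap, ← hμI]
    exact le_refl _
  have hnil : RingHom.ker (ρ : Q →+* B) ^ n = ⊥ := by rw [hρI, hIn]
  -- The kernel `I Q` of `ρ` is nilpotent, so formal smoothness of `B` gives a section of `ρ`. With
  -- one variable for each element of `I`, it extends to a surjection from a polynomial ring over
  -- `B`.
  let s : B →ₐ[k] Q :=
    Algebra.FormallySmooth.liftOfSurjective (AlgHom.id k _) ρ hρ ⟨n, hnil⟩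
  have hs (b) : ρ (s b) = b := Algebra.FormallySmooth.liftOfSurjective_apply _ ρ hρ ⟨n, hnil⟩ b
  let φ : P →ₐ[k] Q := MvPolynomial.aevalTower s fun i : I ↦ μ i.1
  have hφC (b) : φ (MvPolynomial.C b) = s b := MvPolynomial.aevalTower_C _ _ b
  have hφX (i : I) : φ (MvPolynomial.X i) = μ i.1 := MvPolynomial.aevalTower_X _ _ i
  have hT : T.map φ = I.map μ := by
    apply le_antisymm
    · rw [Ideal.map_span, Ideal.span_le]
      rintro _ ⟨_, ⟨i, rfl⟩, rfl⟩
      rw [hφX]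
      exact Ideal.mem_map_of_mem _ i.2
    · rw [Ideal.map_le_iff_le_comap]
      intro a ha
      rw [Ideal.mem_comap, ← hφX ⟨a, ha⟩]
      exact Ideal.mem_map_of_mem _ (Ideal.subset_span ⟨_, rfl⟩)
  have hφ : Function.Surjective φ := by
    refine surjective_of_forall_sub_mem (φ : P →+* Q) T (n := n) (fun q ↦ ?_) (hT ▸ hIn)
    refine ⟨MvPolynomial.C (ρ q), ?_⟩
    have : q - s (ρ q) ∈ RingHom.ker (ρ : Q →+* B) := by
      change ρ _ = 0
      rw [map_sub, hs, sub_self]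
    rw [hρI, ← hT, ← hφC] at this
    exact this
  -- The difference of `p` and its constant coefficient `b` lies in `T`, so `s b ∈ I Q = ker ρ` and
  -- `b = ρ (s b) = 0`.
  have hTI : ∀ p, φ p ∈ I.map μ → p ∈ T := by
    intro p hp
    have h1 : p - MvPolynomial.C (MvPolynomial.constantCoeff p) ∈ T := by
      rw [← pow_one T]
      refine (MvPolynomial.mem_pow_idealOfVars_iff' 1 _).mpr fun x hx ↦ ?_
      have : x = 0 := by simpa [Finsupp.degree_eq_zero_iff] using hx
      subst this
      rw [MvPolynomial.coeff_sub, MvPolynomial.coeff_zero_C, MvPolynomial.constantCoeff_eq,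
        sub_self]
    have h2 : φ (p - MvPolynomial.C (MvPolynomial.constantCoeff p)) ∈ I.map μ :=
      hT ▸ Ideal.mem_map_of_mem φ h1
    rw [map_sub, hφC] at h2
    have h3 : s (MvPolynomial.constantCoeff p) ∈ RingHom.ker (ρ : Q →+* B) :=
      hρI ▸ (Submodule.sub_mem_iff_right _ hp).mp h2
    have h4 : MvPolynomial.constantCoeff p = 0 := by
      rw [← hs (MvPolynomial.constantCoeff p)]
      exact h3
    rwa [h4, map_zero, sub_zero] at h1
  have hflat : Module.Flat B (P ⧸ T ^ n) := flat_quotient_pow_idealOfVars I B n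
  have hflat' : Module.Flat k (P ⧸ T ^ n) := Module.Flat.trans k B (P ⧸ T ^ n)
  have hφT : ∀ p ∈ T ^ n, φ p = 0 := by
    intro p hp
    have h1 : φ p ∈ T.map φ ^ n := by
      rw [← Ideal.map_pow]
      exact Ideal.mem_map_of_mem _ hp
    rwa [hT, hIn] at h1
  refine flat_of_surjective μ hμ I hμI (Ideal.Quotient.liftₐ (T ^ n) φ hφT)
    (Ideal.Quotient.lift_surjective_of_surjective _ _ hφ) (T.map (Ideal.Quotient.mk (T ^ n))) ?_ ?_
  · rw [← Ideal.map_pow, Ideal.map_quotient_self]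
  · intro p hp
    obtain ⟨p, rfl⟩ := Ideal.Quotient.mk_surjective p
    exact Ideal.mem_map_of_mem _ (hTI p hp)

theorem flat_quotient_pow {k A : Type u} [CommRing k] [CommRing A] [Algebra k A] (I : Ideal A)
    [Algebra.FormallySmooth k A] [Algebra.FormallySmooth k (A ⧸ I)] [Module.Flat k (A ⧸ I)]
    (n : ℕ) : Module.Flat k (A ⧸ I ^ n) := by
  -- For `n = 0` the power is the unit ideal, there is no map to `A ⧸ I`, and the quotient is zero.
  rcases Nat.eq_zero_or_pos n with rfl | hn
  · have : Subsingleton (A ⧸ I ^ 0) := Ideal.Quotient.subsingleton_iff.mpr (by simp)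
    infer_instance
  have hle : I ^ n ≤ I := Ideal.pow_le_self hn.ne'
  exact flat_of_ker_eq_pow I n (Ideal.Quotient.mkₐ k (I ^ n)) Ideal.Quotient.mk_surjective
    Ideal.mk_ker (Ideal.Quotient.factorₐ k hle) (Ideal.Quotient.factor_surjective hle)
    (Ideal.Quotient.factor_ker hle)

end Flat

end BlowUp

namespace BlowUp

open TensorProduct

/-! ### Base change of the chart rings. -/

section BaseChange

/-- The elements of `C` are the fractions `a / cᵏ` with `a ∈ I ^ (k • d)`. -/
structure IsChartFraction {A C : Type*} [CommRing A] [CommRing C] (I : Ideal A) (c : A) (d : ℕ)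
    (τ : A →+* C) (frac : ∀ (k : ℕ) (a : A), a ∈ I ^ (k • d) → C) : Prop where
  map_add (k a b ha hb) : frac k (a + b) (add_mem ha hb) = frac k a ha + frac k b hb
  mul_frac (r k a ha) : τ r * frac k a ha = frac k (r * a) (Ideal.mul_mem_left _ _ ha)
  surjective (z) : ∃ k a ha, frac k a ha = z
  frac_pow_mul (k N a ha) (h : c ^ N * a ∈ I ^ ((k + N) • d)) :
    frac (k + N) (c ^ N * a) h = frac k a ha
  eq_zero_iff (k a ha) : frac k a ha = 0 ↔ ∃ N, c ^ N * a = 0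

variable {A S C C' : Type u} [CommRing A] [CommRing S] [CommRing C] [CommRing C']
  {I : Ideal A} {c : A} {d : ℕ}

/-- The canonical map `S ⊗ I → S`. -/
noncomputable def tensorIdealMap (S : Type*) [CommRing S] [Algebra A S] (I : Ideal A) :
    S ⊗[A] I →ₗ[A] S :=
  (TensorProduct.rid A S).toLinearMap ∘ₗ I.subtype.lTensor S

lemma tensorIdealMap_tmul [Algebra A S] (I : Ideal A) (s : S) (a : I) :
    tensorIdealMap S I (s ⊗ₜ a) = algebraMap A S a * s := by
  simp [tensorIdealMap, Algebra.smul_def]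

lemma tensorIdealMap_mem [Algebra A S] (I : Ideal A) (w : S ⊗[A] I) :
    tensorIdealMap S I w ∈ I.map (algebraMap A S) := by
  induction w with
  | zero => simp
  | add x y hx hy => rw [map_add]; exact add_mem hx hy
  | tmul s a =>
    rw [tensorIdealMap_tmul]
    exact Ideal.mul_mem_right _ _ (Ideal.mem_map_of_mem _ a.2)

lemma exists_tensorIdealMap_eq [Algebra A S] (I : Ideal A) (s : S)
    (hs : s ∈ I.map (algebraMap A S)) : ∃ w, tensorIdealMap S I w = s := by
  induction hs using Submodule.span_induction with
  | mem x hx =>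
    obtain ⟨a, ha, rfl⟩ := hx
    exact ⟨1 ⊗ₜ ⟨a, ha⟩, by simp [tensorIdealMap_tmul]⟩
  | zero => exact ⟨0, map_zero _⟩
  | add x y _ _ hx hy =>
    obtain ⟨v, rfl⟩ := hx
    obtain ⟨w, rfl⟩ := hy
    exact ⟨v + w, map_add _ _ _⟩
  | smul t x hx' hx =>
    obtain ⟨w, rfl⟩ := hx
    clear hx'
    refine ⟨(LinearMap.mulLeft A t).rTensor I w, ?_⟩
    induction w with
    | zero => simp
    | add x y hx hy => simp only [map_add, smul_add, hx, hy]
    | tmul s a =>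
      rw [LinearMap.rTensor_tmul, tensorIdealMap_tmul, tensorIdealMap_tmul,
        LinearMap.mulLeft_apply, smul_eq_mul]
      ring

/-- `C` is the colimit of the modules `I ^ (k • d)` under multiplication by `c`, and `C'` that of
the `J ^ (k • d)`. Since `J = I S`, the maps `S ⊗ I ^ n → J ^ n` are surjective; by `hinj` they are
injective, so `S ⊗ C → C'` is bijective. -/
theorem isPushout_of_isChartFraction [Algebra A S] [Algebra A C] [Algebra S C'] [Algebra C C']
    [Algebra A C'] [IsScalarTower A S C'] [IsScalarTower A C C']
    {frac : ∀ (k : ℕ) (a : A), a ∈ I ^ (k • d) → C}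
    (h : IsChartFraction I c d (algebraMap A C) frac)
    {J : Ideal S} (hJ : I.map (algebraMap A S) = J)
    {frac' : ∀ (k : ℕ) (a : S), a ∈ J ^ (k • d) → C'}
    (h' : IsChartFraction J (algebraMap A S c) d (algebraMap S C') frac')
    (hc : c ∈ I ^ d)
    (hfrac : ∀ k a ha ha', algebraMap C C' (frac k a ha) = frac' k (algebraMap A S a) ha')
    (hinj : ∀ n, Function.Injective (tensorIdealMap S (I ^ n))) :
    Algebra.IsPushout A S C C' := by
  let ι (k : ℕ) : ↥(I ^ (k • d)) →ₗ[A] C :=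
    { toFun a := frac k a.1 a.2
      map_add' a b := h.map_add k a b a.2 b.2
      map_smul' r a := by
        exact (h.mul_frac r k a.1 a.2).symm.trans (Algebra.smul_def _ _).symm }
  have hpow (N : ℕ) {k : ℕ} {a : A} (ha : a ∈ I ^ (k • d)) : c ^ N * a ∈ I ^ ((k + N) • d) := by
    rw [add_comm, add_smul, pow_add, smul_eq_mul, mul_comm N d, pow_mul]
    exact Ideal.mul_mem_mul (Ideal.pow_mem_pow hc N) ha
  let μ (N k : ℕ) : ↥(I ^ (k • d)) →ₗ[A] ↥(I ^ ((k + N) • d)) :=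
    { toFun a := ⟨c ^ N * a.1, hpow N a.2⟩
      map_add' a b := Subtype.ext (mul_add _ _ _)
      map_smul' r a := Subtype.ext (by simp [mul_left_comm]) }
  have hιμ (N k : ℕ) : ι (k + N) ∘ₗ μ N k = ι k := by
    ext a
    exact h.frac_pow_mul k N a.1 a.2 _
  have hιμ' (N k : ℕ) (w : S ⊗[A] ↥(I ^ (k • d))) :
      (ι (k + N)).lTensor S ((μ N k).lTensor S w) = (ι k).lTensor S w := by
    rw [← LinearMap.comp_apply, ← LinearMap.lTensor_comp, hιμ]
  have hall (z : S ⊗[A] C) : ∃ k w, (ι k).lTensor S w = z := by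
    induction z with
    | zero => exact ⟨0, 0, map_zero _⟩
    | tmul s z =>
      obtain ⟨k, a, ha, rfl⟩ := h.surjective z
      exact ⟨k, s ⊗ₜ ⟨a, ha⟩, rfl⟩
    | add x y hx hy =>
      obtain ⟨k, v, rfl⟩ := hx
      obtain ⟨l, w, rfl⟩ := hy
      obtain ⟨w', hw'⟩ : ∃ w', (ι (k + l)).lTensor S w' = (ι l).lTensor S w := by
        rw [add_comm k l]
        exact ⟨_, hιμ' k l w⟩
      exact ⟨k + l, (μ l k).lTensor S v + w', by rw [map_add, hιμ', hw']⟩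
  have hJn (n : ℕ) (w : S ⊗[A] ↥(I ^ n)) : tensorIdealMap S (I ^ n) w ∈ J ^ n := by
    rw [← hJ, ← Ideal.map_pow]
    exact tensorIdealMap_mem _ w
  let L : S ⊗[A] C →ₗ[A] C' := TensorProduct.lift
    (((Algebra.linearMap S (Module.End S (C →ₗ[A] C'))).flip
      (IsScalarTower.toAlgHom A C C').toLinearMap).restrictScalars A)
  have hLtmul (s : S) (z : C) : L (s ⊗ₜ z) = algebraMap S C' s * algebraMap C C' z := by
    change s • algebraMap C C' z = _
    rw [Algebra.smul_def]
  have hL (k : ℕ) (w : S ⊗[A] ↥(I ^ (k • d))) :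
      L ((ι k).lTensor S w) = frac' k (tensorIdealMap S _ w) (hJn _ w) := by
    have h0 (hm : (0 : S) ∈ J ^ (k • d)) : frac' k 0 hm = 0 :=
      (h'.eq_zero_iff k 0 hm).mpr ⟨0, mul_zero _⟩
    induction w with
    | zero => simp only [map_zero, h0]
    | add x y hx hy =>
      simp only [map_add, hx, hy]
      exact (h'.map_add k _ _ _ _).symm
    | tmul s a =>
      have ha' : algebraMap A S a.1 ∈ J ^ (k • d) := by
        rw [← hJ, ← Ideal.map_pow]
        exact Ideal.mem_map_of_mem _ a.2
      rw [LinearMap.lTensor_tmul, hLtmul]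
      change _ * algebraMap C C' (frac k a.1 a.2) = _
      rw [hfrac k a.1 a.2 ha', h'.mul_frac]
      congr 1
      rw [tensorIdealMap_tmul, mul_comm]
  have hμ (N k : ℕ) (w : S ⊗[A] ↥(I ^ (k • d))) :
      tensorIdealMap S _ ((μ N k).lTensor S w) =
        algebraMap A S c ^ N * tensorIdealMap S _ w := by
    induction w with
    | zero => simp
    | add x y hx hy => simp only [map_add, mul_add, hx, hy]
    | tmul s a =>
      rw [LinearMap.lTensor_tmul, tensorIdealMap_tmul, tensorIdealMap_tmul]
      change algebraMap A S (c ^ N * a.1) * s = _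
      rw [map_mul, map_pow, mul_assoc]
  refine ⟨show Function.Bijective L from ⟨?_, fun y ↦ ?_⟩⟩
  -- An element of the kernel comes from some `w` at level `k`. Its image in `S` is killed by a
  -- power `c ^ N`, so by `hinj` already `μ N k` kills `w`, at level `k + N`.
  · rw [injective_iff_map_eq_zero]
    intro z hz
    obtain ⟨k, w, rfl⟩ := hall z
    rw [hL, h'.eq_zero_iff] at hz
    obtain ⟨N, hN⟩ := hz
    rw [← hμ] at hN
    have := (injective_iff_map_eq_zero _).mp (hinj _) _ hN
    rw [← hιμ' N k w, this, map_zero]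
  · obtain ⟨k, a, ha, rfl⟩ := h'.surjective y
    have ha' := ha
    rw [← hJ, ← Ideal.map_pow] at ha'
    obtain ⟨w, rfl⟩ := exists_tensorIdealMap_eq _ _ ha'
    exact ⟨_, hL k w⟩

lemma isChartFraction_chartFrac (I : Ideal A) (hc : c ∈ I ^ d) :
    IsChartFraction I c d (toAway I (reesMonomial I d c hc)) (chartFrac hc) where
  map_add := chartFrac_add hc
  mul_frac := toAway_mul_chartFrac hc
  surjective := chartFrac_surjective hc
  frac_pow_mul k N a ha h := (chartFrac_eq_iff hc _ _ _ _ _ _).mpr ⟨0, by ring⟩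
  eq_zero_iff := chartFrac_eq_zero_iff hc

/-- As `S = K ⊗[k] A`, the map is `K ⊗[k] I → K ⊗[k] A`, which is injective because `A ⧸ I` is flat
over `k`. -/
lemma tensorIdealMap_injective (k K : Type u) [CommRing k] [CommRing K] [Algebra k K]
    [Algebra k A] [Algebra A S] [Algebra K S] [Algebra k S] [IsScalarTower k A S]
    [IsScalarTower k K S] [Algebra.IsPushout k K A S] (I : Ideal A) [Module.Flat k (A ⧸ I)] :
    Function.Injective (tensorIdealMap S I) := by
  rw [tensorIdealMap, LinearMap.coe_comp]
  refine (TensorProduct.rid A S).injective.comp ?_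
  have h1 : Function.Injective ((I.subtype.restrictScalars k).lTensor K) := by
    refine LinearMap.lTensor_injective_of_exact_of_flat (Ideal.Quotient.mkₐ k I).toLinearMap
      Ideal.Quotient.mk_surjective _ I.subtype_injective ?_ K
    intro a
    change Ideal.Quotient.mk I a = 0 ↔ _
    rw [Ideal.Quotient.eq_zero_iff_mem]
    simp
  have h2 (w : K ⊗[k] I) : I.subtype.lTensor S
      ((Algebra.IsPushout.cancelBaseChange k K A S I).symm w) =
      (Algebra.IsPushout.cancelBaseChange k K A S A).symm
        ((I.subtype.restrictScalars k).lTensor K w) := by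
    induction w with
    | zero => simp only [LinearEquiv.map_zero, LinearMap.map_zero]
    | add x y hx hy => simp only [map_add, hx, hy]
    | tmul x y =>
      rw [Algebra.IsPushout.cancelBaseChange_symm_tmul, LinearMap.lTensor_tmul,
        LinearMap.lTensor_tmul]
      exact (Algebra.IsPushout.cancelBaseChange_symm_tmul k K A S A x y.1).symm
  intro v w hvw
  obtain ⟨v, rfl⟩ := (Algebra.IsPushout.cancelBaseChange k K A S I).symm.surjective v
  obtain ⟨w, rfl⟩ := (Algebra.IsPushout.cancelBaseChange k K A S I).symm.surjective w
  rw [h2, h2] at hvw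
  rw [h1 ((Algebra.IsPushout.cancelBaseChange k K A S A).symm.injective hvw)]

end BaseChange

end BlowUp

namespace BlowUp

open TensorProduct Polynomial

/-! ### Base change of affine blow-ups. -/

section AffineBaseChange

variable {A S : Type u} [CommRing A] [CommRing S] {I : Ideal A} {J : Ideal S}

theorem isPushout_away {C C' : Type u} [CommRing C] [CommRing C'] {c : A} {d : ℕ} (φ : A →+* S)
    (hJ : I.map φ = J) (a : A →+* C) (b : S →+* C') (g : C →+* C') (hg : g.comp a = b.comp φ)
    {frac : ∀ (k : ℕ) (a : A), a ∈ I ^ (k • d) → C} (h : IsChartFraction I c d a frac)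
    {frac' : ∀ (k : ℕ) (a : S), a ∈ J ^ (k • d) → C'} (h' : IsChartFraction J (φ c) d b frac')
    (hc : c ∈ I ^ d) (hfrac : ∀ k a ha ha', g (frac k a ha) = frac' k (φ a) ha')
    (hinj : letI := φ.toAlgebra; ∀ n, Function.Injective (tensorIdealMap S (I ^ n))) :
    IsPushout (CommRingCat.ofHom a) (CommRingCat.ofHom φ) (CommRingCat.ofHom g)
      (CommRingCat.ofHom b) := by
  algebraize [φ, a, b, g, b.comp φ]
  have : IsScalarTower A C C' := .of_algebraMap_eq' hg.symm
  refine IsPushout.flip ((CommRingCat.isPushout_iff_isPushout ..).mpr ?_)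
  exact isPushout_of_isChartFraction h hJ h' hc hfrac hinj

/-- The chart ring depends on `t`, which is only propositionally a `reesMonomial`, for instance when
it is an image under `reesMap`. -/
lemma exists_isChartFraction {c : A} {d : ℕ} (hc : c ∈ I ^ d) (t : reesAlgebra I)
    (ht : t = reesMonomial I d c hc) :
    ∃ frac : ∀ (k : ℕ) (a : A), a ∈ I ^ (k • d) → HomogeneousLocalization.Away (reesGrading I) t,
      IsChartFraction I c d (toAway I t) frac ∧ ∀ k a ha, (frac k a ha).val =
        Localization.mk (reesMonomial I (k • d) a ha)
          (⟨t ^ k, k, rfl⟩ : Submonoid.powers t) := by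
  subst ht
  exact ⟨chartFrac hc, isChartFraction_chartFrac I hc, fun _ _ _ ↦ rfl⟩

lemma isPushout_away_map (φ : A →+* S) (h : I.map φ = J)
    (hinj : letI := φ.toAlgebra; ∀ n, Function.Injective (tensorIdealMap S (I ^ n)))
    {n : ℕ} (s : reesAlgebra I) (hs : s ∈ reesGrading I n) :
    IsPushout (CommRingCat.ofHom (toAway I s)) (CommRingCat.ofHom φ)
      (CommRingCat.ofHom (HomogeneousLocalization.Away.map (reesMap I φ h.le) s))
      (CommRingCat.ofHom (toAway J (reesMap I φ h.le s))) := by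
  have hc : s.1.coeff n ∈ I ^ n := s.2 n
  have hc' : φ (s.1.coeff n) ∈ J ^ n := by
    rw [← h, ← Ideal.map_pow]
    exact Ideal.mem_map_of_mem _ hc
  have hs1 : s.1 = monomial n (s.1.coeff n) := mem_reesGrading_iff.mp hs
  have hs' : reesMap I φ h.le s = reesMonomial J n (φ (s.1.coeff n)) hc' := by
    apply Subtype.ext
    rw [reesMap_val]
    conv_lhs => rw [hs1]
    rw [map_monomial]
    rfl
  obtain ⟨frac, hf, hfv⟩ := exists_isChartFraction hc s (eq_reesMonomial hs)
  obtain ⟨frac', hf', hfv'⟩ := exists_isChartFraction hc' _ hs'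
  refine isPushout_away φ h _ _ _ (away_map_comp_toAway I φ h s) hf hf' hc ?_ hinj
  intro k a ha ha'
  have e : frac k a ha = HomogeneousLocalization.Away.mk _ hs k (reesMonomial I (k • n) a ha)
      (reesMonomial_mem _ _ _ _) := by
    apply HomogeneousLocalization.val_injective
    rw [hfv, HomogeneousLocalization.Away.val_mk]
  apply HomogeneousLocalization.val_injective
  rw [e, hfv', HomogeneousLocalization.Away.map_mk, HomogeneousLocalization.Away.val_mk]
  congr 1
  apply Subtype.ext
  rw [reesMap_val]
  simp [reesMonomial]

/-- If all `I ^ n ⊗ S → S` are injective, the blow-up of `I` commutes with the base change to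
`S`. -/
theorem isPullback_affineBlowup_of_injective (φ : A →+* S) (h : I.map φ = J)
    (hinj : letI := φ.toAlgebra; ∀ n, Function.Injective (tensorIdealMap S (I ^ n))) :
    IsPullback (affineBlowupMap I φ h) (affineBlowupπ J) (affineBlowupπ I)
      (Spec.map (CommRingCat.ofHom φ)) := by
  refine Scheme.isPullback_of_openCover _ _ _ _ (Proj.affineOpenCover (reesGrading I)).openCover
    fun (s : (i : ℕ+) × reesGrading I i) ↦ ?_
  have hn : 0 < (s.1 : ℕ) := s.1.2
  have hs : s.2.1 ∈ reesGrading I s.1 := s.2.2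
  let f := reesMap I φ h.le
  have hs' : f s.2.1 ∈ reesGrading J s.1 := f.map_mem hs
  have h1 : IsPullback (Proj.awayι (reesGrading J) (f s.2.1) hs' hn)
      (Spec.map (CommRingCat.ofHom (HomogeneousLocalization.Away.map f s.2.1)))
      (affineBlowupMap I φ h) (Proj.awayι (reesGrading I) s.2.1 hs hn) := by
    refine (IsOpenImmersion.isPullback _ _ _ _ ?_ ?_).flip
    · exact Proj.awayι_comp_map f _ hn s.2.1 hs
    · rw [Proj.opensRange_awayι, Proj.opensRange_awayι]
      rfl
  have h2 : IsPullback (Spec.map (CommRingCat.ofHom (HomogeneousLocalization.Away.map f s.2.1)))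
      (Spec.map (CommRingCat.ofHom (toAway J (f s.2.1))))
      (Spec.map (CommRingCat.ofHom (toAway I s.2.1)))
      (Spec.map (CommRingCat.ofHom φ)) :=
    isPullback_SpecMap_of_isPushout _ _ _ _ (isPushout_away_map φ h hinj s.2.1 hs)
  refine h2.of_iso h1.isoPullback (Iso.refl _) (Iso.refl _) (Iso.refl _) ?_ ?_ ?_ ?_
  · exact (Category.comp_id _).trans h1.isoPullback_hom_snd.symm
  · refine (Category.comp_id _).trans ?_
    refine Eq.trans (awayι_affineBlowupπ J hn (f s.2.1) hs').symm ?_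
    exact (congr($(h1.isoPullback_hom_fst) ≫ affineBlowupπ J)).symm.trans (Category.assoc _ _ _)
  · refine (Category.comp_id _).trans ?_
    refine Eq.trans (awayι_affineBlowupπ I hn s.2.1 hs).symm ?_
    exact (Category.id_comp _).symm
  · simp

/-- Blowing up the smooth center `I` of a smooth algebra commutes with base change. -/
theorem isPullback_affineBlowup_of_formallySmooth {k K : CommRingCat.{u}} {A S : CommRingCat.{u}}
    {f : k ⟶ A} {g : k ⟶ K} {φ : A ⟶ S} {ψ : K ⟶ S} (sq : IsPushout f g φ ψ) (I : Ideal A)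
    (J : Ideal S) (h : I.map φ.hom = J) (hA : f.hom.FormallySmooth)
    (hB : ((Ideal.Quotient.mk I).comp f.hom).FormallySmooth)
    (hBflat : ((Ideal.Quotient.mk I).comp f.hom).Flat) :
    IsPullback (affineBlowupMap I φ.hom h) (affineBlowupπ J) (affineBlowupπ I) (Spec.map φ) := by
  refine isPullback_affineBlowup_of_injective φ.hom h fun n ↦ ?_
  algebraize [f.hom, g.hom, φ.hom, ψ.hom, ψ.hom.comp g.hom]
  have : IsScalarTower k A S := .of_algebraMap_eq' congr($(sq.w).hom).symm
  have : Algebra.IsPushout k K A S :=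
    (CommRingCat.isPushout_iff_isPushout ..).mp sq.flip
  have : Algebra.FormallySmooth k (A ⧸ I) := hB
  have : Module.Flat k (A ⧸ I) := hBflat
  have := flat_quotient_pow (k := k) I n
  exact tensorIdealMap_injective k K (I ^ n)

end AffineBaseChange

end BlowUp

namespace BlowUp

open Limits

/-! ### The inverse image ideal sheaf on affine opens. -/

section Comap

/-- By the universal property `P` maps to `S / (ker a) S` under `S`, so whatever dies in `P` lies in
`(ker a) S`. -/
lemma ker_eq_map_ker_of_isPushout {A B S P : CommRingCat.{u}} {a : A ⟶ B} {φ : A ⟶ S}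
    {b : B ⟶ P} {s : S ⟶ P} (sq : IsPushout φ a s b) (ha : Function.Surjective a.hom) :
    RingHom.ker s.hom = (RingHom.ker a.hom).map φ.hom := by
  apply le_antisymm
  · let q : S ⟶ .of (S ⧸ (RingHom.ker a.hom).map φ.hom) :=
      CommRingCat.ofHom (Ideal.Quotient.mk _)
    have hq : RingHom.ker a.hom ≤ RingHom.ker (φ ≫ q).hom := fun x hx ↦
      Ideal.Quotient.eq_zero_iff_mem.mpr (Ideal.mem_map_of_mem _ hx)
    let b' : B ⟶ .of (S ⧸ (RingHom.ker a.hom).map φ.hom) :=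
      CommRingCat.ofHom (RingHom.liftOfRightInverse a.hom (Function.surjInv ha)
        (Function.rightInverse_surjInv ha) ⟨(φ ≫ q).hom, hq⟩)
    have hb' : φ ≫ q = a ≫ b' := by
      ext x
      exact (RingHom.liftOfRightInverse_comp_apply a.hom (Function.surjInv ha)
        (Function.rightInverse_surjInv ha) ⟨(φ ≫ q).hom, hq⟩ x).symm
    intro x hx
    have h1 : sq.desc q b' hb' (s x) = q x := congr($(sq.inl_desc q b' hb').hom x)
    have h2 : s x = 0 := hx
    rw [h2, map_zero] at h1
    exact Ideal.Quotient.eq_zero_iff_mem.mp h1.symm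
  · rw [Ideal.map_le_iff_le_comap]
    intro x hx
    have h1 : s (φ x) = b (a x) := congr($(sq.w).hom x)
    change s (φ x) = 0
    rw [h1, show a x = 0 from hx, map_zero]

variable {X Y : Scheme.{u}} (I : X.IdealSheafData) (g : Y ⟶ X)

/-- The inverse image ideal is the kernel of `𝒪_Y` onto the pulled back closed subscheme; on affine
opens the sections form a pushout square. -/
lemma ideal_comap (U : X.affineOpens) (V : Y.affineOpens) (e : V.1 ≤ g ⁻¹ᵁ U.1) :
    (I.comap g).ideal V = (I.ideal U).map (g.appLE U.1 V.1 e).hom := by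
  have hUY : pullback.fst g I.subschemeι ⁻¹ᵁ V.1 =
      pullback.fst g I.subschemeι ⁻¹ᵁ V.1 ⊓
        pullback.snd g I.subschemeι ⁻¹ᵁ (I.subschemeι ⁻¹ᵁ U.1) := by
    rw [← Scheme.Hom.comp_preimage, ← pullback.condition, Scheme.Hom.comp_preimage]
    exact (inf_eq_left.mpr (Scheme.Hom.preimage_mono _ e)).symm
  have hpo := (isIso_pushoutSection_iff (IsPullback.of_hasPullback g I.subschemeι)
    (US := U.1) (UT := I.subschemeι ⁻¹ᵁ U.1) (UX := V.1) le_rfl e hUY).mp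
    (isIso_pushoutSection_of_isAffineOpen _ _ _ _ U.2 (U.2.preimage I.subschemeι) V.2)
  have hker := ker_eq_map_ker_of_isPushout hpo
    (by simpa [Scheme.Hom.appLE] using I.subschemeι_app_surjective U)
  rw [Scheme.IdealSheafData.comap, Scheme.Hom.ker_apply]
  simpa [Scheme.Hom.appLE_eq_app, I.ker_subschemeι_app] using hker

end Comap

/-! ### Gluing the local base change maps. -/

section Gluing

variable {X Y : Scheme.{u}} (I : X.IdealSheafData) (g : Y ⟶ X)

lemma opensRange_blowupι (U : X.affineOpens) :
    (blowupι I U).opensRange = blowupπ I ⁻¹ᵁ U.1 := by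
  have := (blowupGluingData I).toBase_preimage_eq_opensRange_ι ⟨U.1, U.2⟩
  refine this.symm.trans ?_
  change blowupπ I ⁻¹ᵁ U.1.ι.opensRange = _
  rw [Scheme.Opens.opensRange_ι]

lemma blowupι_π (U : X.affineOpens) :
    blowupι I U ≫ blowupπ I = affineBlowupπ (I.ideal U) ≫ U.2.fromSpec := by
  rw [← (isPullback_blowupι I U).w, Category.assoc]
  rfl

lemma relativeGluingData_map_cover_f {𝒰 : X.OpenCover} [Category* 𝒰.I₀] [Quiver.IsThin 𝒰.I₀]
    [𝒰.LocallyDirected] [Small.{u} 𝒰.I₀] (d : 𝒰.RelativeGluingData) {i j : 𝒰.I₀} (f : i ⟶ j) :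
    d.functor.map f ≫ d.cover.f j = d.cover.f i :=
  colimit.w d.functor f

/-- The map of affine blow-ups over an inclusion of affine opens. -/
noncomputable def blowupRes {U V : X.affineOpens} (h : U ≤ V) :
    affineBlowup (I.ideal U) ⟶ affineBlowup (I.ideal V) :=
  affineBlowupMap (S := Γ(X, U.1)) (J := I.ideal U) (I.ideal V)
    (X.presheaf.map (homOfLE (show U.1 ≤ V.1 from h)).op).hom (I.map_ideal h)

/-- An affine open as an object of the small affine Zariski site. -/
abbrev toSite (U : X.affineOpens) : X.AffineZariskiSite := ⟨U.1, U.2⟩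

lemma blowupRes_blowupι {U V : X.affineOpens} (h : U ≤ V)
    (h' : ∃ r : Γ(X, V.1), X.basicOpen r = U.1) :
    blowupRes I h ≫ blowupι I V = blowupι I U :=
  relativeGluingData_map_cover_f (blowupGluingData I)
    (homOfLE (show toSite U ≤ toSite V from h'))

variable [IsAffineHom g]

/-- The preimage of an affine open under an affine morphism. -/
abbrev affinePreimage (U : X.affineOpens) : Y.affineOpens := ⟨g ⁻¹ᵁ U.1, U.2.preimage g⟩

lemma affinePreimage_mono : Monotone (affinePreimage g) :=
  fun _ _ h ↦ Scheme.Hom.preimage_mono g h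

lemma exists_basicOpen_eq_affinePreimage {U V : X.affineOpens}
    (h : ∃ r : Γ(X, V.1), X.basicOpen r = U.1) :
    ∃ r : Γ(Y, (affinePreimage g V).1), Y.basicOpen r = (affinePreimage g U).1 := by
  obtain ⟨r, hr⟩ := h
  refine ⟨g.app _ r, ?_⟩
  change _ = g ⁻¹ᵁ U.1
  rw [← hr]
  exact (Scheme.preimage_basicOpen g r).symm

lemma map_ideal_app (U : X.affineOpens) :
    (I.ideal U).map (g.app U.1).hom = (I.comap g).ideal (affinePreimage g U) := by
  rw [ideal_comap I g U (affinePreimage g U) le_rfl]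
  congr 2
  exact (Scheme.Hom.appLE_eq_app g).symm

/-- The part of the blow-up of `Y` over the preimage of `U`. -/
noncomputable def pieceLift (U : X.affineOpens) :
    pullback (blowupπ (I.comap g) ≫ g) U.1.ι ⟶
      affineBlowup ((I.comap g).ideal (affinePreimage g U)) :=
  IsOpenImmersion.lift (blowupι (I.comap g) (affinePreimage g U))
    (pullback.fst _ _) (by
      rw [← Scheme.Hom.coe_opensRange, ← Scheme.Hom.coe_opensRange, opensRange_blowupι,
        Scheme.Hom.opensRange_pullbackFst, Scheme.Opens.opensRange_ι]
      rfl)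

lemma pieceLift_blowupι (U : X.affineOpens) :
    pieceLift I g U ≫ blowupι (I.comap g) (affinePreimage g U) = pullback.fst _ _ :=
  IsOpenImmersion.lift_fac _ _ _

/-- The morphism of blow-ups over an affine open. -/
noncomputable def pieceMap (U : X.affineOpens) :
    affineBlowup ((I.comap g).ideal (affinePreimage g U)) ⟶ affineBlowup (I.ideal U) :=
  affineBlowupMap _ (g.app U.1).hom (map_ideal_app I g U)

/-- Both composites are induced by the same ring map, since `g` commutes with restriction. -/
lemma blowupRes_pieceMap {U V : X.affineOpens} (h : U ≤ V) :
    blowupRes (I.comap g) (affinePreimage_mono g h) ≫ pieceMap I g V =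
      pieceMap I g U ≫ blowupRes I h := by
  have e : (Y.presheaf.map (homOfLE (affinePreimage_mono g h)).op).hom.comp (g.app V.1).hom =
      (g.app U.1).hom.comp (X.presheaf.map (homOfLE h).op).hom :=
    congr($(g.naturality (homOfLE h).op).hom).symm
  have h1 := I.map_ideal h
  have h2 := (I.comap g).map_ideal (affinePreimage_mono g h)
  have h3 : (I.ideal V).map
      ((Y.presheaf.map (homOfLE (affinePreimage_mono g h)).op).hom.comp (g.app V.1).hom) =
      (I.comap g).ideal (affinePreimage g U) :=
    (Ideal.map_map _ _).symm.trans ((congrArg (Ideal.map _) (map_ideal_app I g V)).trans h2)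
  refine (affineBlowupMap_comp _ _ (map_ideal_app I g V) _ h2 h3).symm.trans
    (Eq.trans ?_ (affineBlowupMap_comp _ _ h1 _ (map_ideal_app I g U) (e ▸ h3)))
  congr 1

lemma comp_pieceLift_pieceMap {U V : X.affineOpens} (h : U ≤ V)
    (h' : ∃ r : Γ(X, V.1), X.basicOpen r = U.1)
    (t : pullback (blowupπ (I.comap g) ≫ g) U.1.ι ⟶ pullback (blowupπ (I.comap g) ≫ g) V.1.ι)
    (ht : t ≫ pullback.fst _ _ = pullback.fst _ _) :
    t ≫ pieceLift I g V ≫ pieceMap I g V ≫ blowupι I V =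
      pieceLift I g U ≫ pieceMap I g U ≫ blowupι I U := by
  have e : t ≫ pieceLift I g V =
      pieceLift I g U ≫ blowupRes (I.comap g) (affinePreimage_mono g h) := by
    rw [← cancel_mono (blowupι (I.comap g) (affinePreimage g V)), Category.assoc, Category.assoc,
      blowupRes_blowupι _ _ (exists_basicOpen_eq_affinePreimage g h'), pieceLift_blowupι,
      pieceLift_blowupι, ht]
  rw [reassoc_of% e, reassoc_of% blowupRes_pieceMap I g h, blowupRes_blowupι I h h']

lemma trans_comp_pieceLift_pieceMap {U V : X.AffineZariskiSite} (f : U ⟶ V) :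
    Scheme.Cover.trans
        ((Scheme.AffineZariskiSite.directedCover X).pullback₁ (blowupπ (I.comap g) ≫ g)) f ≫
      pieceLift I g ⟨V.1, V.2⟩ ≫ pieceMap I g ⟨V.1, V.2⟩ ≫ blowupι I ⟨V.1, V.2⟩ =
    pieceLift I g ⟨U.1, U.2⟩ ≫ pieceMap I g ⟨U.1, U.2⟩ ≫ blowupι I ⟨U.1, U.2⟩ :=
  comp_pieceLift_pieceMap I g (U := ⟨U.1, U.2⟩) (V := ⟨V.1, V.2⟩)
    (Scheme.AffineZariskiSite.toOpens_mono f.le) f.le _ (Scheme.Cover.trans_map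
      ((Scheme.AffineZariskiSite.directedCover X).pullback₁ (blowupπ (I.comap g) ≫ g)) f)

/-- The morphism from the blow-up of the pulled back ideal to the blow-up. -/
noncomputable def blowupComapMap : blowup (I.comap g) ⟶ blowup I :=
  Scheme.OpenCover.glueMorphismsOfLocallyDirected
    ((Scheme.AffineZariskiSite.directedCover X).pullback₁ (blowupπ (I.comap g) ≫ g))
    (fun U : X.AffineZariskiSite ↦ pieceLift I g ⟨U.1, U.2⟩ ≫ pieceMap I g ⟨U.1, U.2⟩ ≫
      blowupι I ⟨U.1, U.2⟩)
    (trans_comp_pieceLift_pieceMap I g)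

lemma fst_blowupComapMap (U : X.affineOpens) :
    pullback.fst (blowupπ (I.comap g) ≫ g) U.1.ι ≫ blowupComapMap I g =
      pieceLift I g U ≫ pieceMap I g U ≫ blowupι I U :=
  Scheme.OpenCover.map_glueMorphismsOfLocallyDirected
    ((Scheme.AffineZariskiSite.directedCover X).pullback₁ (blowupπ (I.comap g) ≫ g))
    (fun U : X.AffineZariskiSite ↦ pieceLift I g ⟨U.1, U.2⟩ ≫ pieceMap I g ⟨U.1, U.2⟩ ≫
      blowupι I ⟨U.1, U.2⟩) (trans_comp_pieceLift_pieceMap I g) (toSite U)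

lemma blowupι_blowupComapMap (U : X.affineOpens) :
    blowupι (I.comap g) (affinePreimage g U) ≫ blowupComapMap I g =
      pieceMap I g U ≫ blowupι I U := by
  have w : blowupι (I.comap g) (affinePreimage g U) ≫ blowupπ (I.comap g) ≫ g =
      ((affineBlowupπ ((I.comap g).ideal (affinePreimage g U)) ≫
        (affinePreimage g U).2.isoSpec.inv) ≫ g ∣_ U.1) ≫ U.1.ι := by
    refine (congr($((isPullback_blowupι (I.comap g) (affinePreimage g U)).w) ≫ g)).symm.trans ?_
    rw [Category.assoc _ _ U.1.ι, morphismRestrict_ι, Category.assoc]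
  let s : affineBlowup ((I.comap g).ideal (affinePreimage g U)) ⟶
      pullback (blowupπ (I.comap g) ≫ g) U.1.ι := pullback.lift _ _ w
  have h1 : s ≫ pullback.fst _ _ = blowupι (I.comap g) (affinePreimage g U) :=
    pullback.lift_fst _ _ w
  have h2 : s ≫ pieceLift I g U = 𝟙 _ := by
    rw [← cancel_mono (blowupι (I.comap g) (affinePreimage g U)), Category.assoc,
      pieceLift_blowupι, h1, Category.id_comp]
  rw [← h1, Category.assoc, fst_blowupComapMap, reassoc_of% h2]

lemma pieceMap_π (U : X.affineOpens) :
    pieceMap I g U ≫ affineBlowupπ (I.ideal U) = affineBlowupπ _ ≫ Spec.map (g.app U.1) :=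
  affineBlowupMap_π _ _ _

omit [IsAffineHom g] in
lemma isPullback_fromSpec {U : X.Opens} (hU : IsAffineOpen U) (hV : IsAffineOpen (g ⁻¹ᵁ U)) :
    IsPullback (Spec.map (g.app U)) hV.fromSpec hU.fromSpec g := by
  refine IsOpenImmersion.isPullback _ _ _ _ ?_ ?_
  · rw [← IsAffineOpen.SpecMap_appLE_fromSpec g hU hV le_rfl, Scheme.Hom.appLE_eq_app]
  · rw [IsAffineOpen.opensRange_fromSpec, IsAffineOpen.opensRange_fromSpec]

lemma pieceMap_blowupι_π (U : X.affineOpens) : pieceMap I g U ≫ blowupι I U ≫ blowupπ I =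
    blowupι (I.comap g) (affinePreimage g U) ≫ blowupπ (I.comap g) ≫ g := by
  have e1 := pieceMap_π I g U
  have e2 := (isPullback_fromSpec g U.2 (affinePreimage g U).2).w
  have e3 := blowupι_π (I.comap g) (affinePreimage g U)
  rw [blowupι_π, reassoc_of% e1, e2, reassoc_of% e3]

lemma blowupComapMap_π : blowupComapMap I g ≫ blowupπ I = blowupπ (I.comap g) ≫ g := by
  refine Scheme.Cover.hom_ext ((Scheme.AffineZariskiSite.directedCover X).pullback₁
    (blowupπ (I.comap g) ≫ g)) _ _ fun (U : X.AffineZariskiSite) ↦ ?_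
  let U' : X.affineOpens := ⟨U.1, U.2⟩
  change pullback.fst _ _ ≫ _ = pullback.fst (blowupπ (I.comap g) ≫ g) (Scheme.Opens.ι U'.1) ≫ _
  rw [reassoc_of% fst_blowupComapMap I g U', pieceMap_blowupι_π,
    reassoc_of% pieceLift_blowupι I g U']

/-- The blow-up commutes with the affine base change `g` if it does so locally. -/
theorem isPullback_blowupComapMap
    (H : ∀ U : X.affineOpens, IsPullback (pieceMap I g U) (affineBlowupπ _)
      (affineBlowupπ (I.ideal U)) (Spec.map (g.app U.1))) :
    IsPullback (blowupComapMap I g) (blowupπ (I.comap g)) (blowupπ I) g := by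
  refine Scheme.isPullback_of_openCover _ _ _ _ (blowupGluingData I).cover
    fun (U₀ : X.AffineZariskiSite) ↦ ?_
  let U : X.affineOpens := ⟨U₀.1, U₀.2⟩
  -- By `blowupComapMap_π`, the preimage of the piece over `U` is the piece over `g ⁻¹ᵁ U`, so the
  -- global square restricts to the affine one.
  have h1 : IsPullback (blowupι (I.comap g) (affinePreimage g U)) (pieceMap I g U)
      (blowupComapMap I g) (blowupι I U) := by
    refine (IsOpenImmersion.isPullback _ _ _ _ (blowupι_blowupComapMap I g U) ?_).flip
    rw [opensRange_blowupι, opensRange_blowupι, ← Scheme.Hom.comp_preimage, blowupComapMap_π]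
    rfl
  have h2 : IsPullback (pieceMap I g U)
      (blowupι (I.comap g) (affinePreimage g U) ≫ blowupπ (I.comap g))
      (blowupι I U ≫ blowupπ I) g := by
    rw [blowupι_π, blowupι_π]
    exact (H U).paste_vert (isPullback_fromSpec g U.2 _)
  refine h2.of_iso h1.isoPullback (Iso.refl _) (Iso.refl _) (Iso.refl _) ?_ ?_ ?_ ?_
  · exact (Category.comp_id _).trans h1.isoPullback_hom_snd.symm
  · refine (Category.comp_id _).trans ?_
    exact (congr($(h1.isoPullback_hom_fst) ≫ blowupπ (I.comap g))).symm.trans (Category.assoc _ _ _)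
  · exact (Category.comp_id _).trans (Category.id_comp _).symm
  · simp

end Gluing

end BlowUp

namespace BlowUp

/-! ### Smooth centres over an affine base, and fibres. -/

section SmoothBaseChange

/-- `Γ(X, U) ⧸ I(U)` is the ring of sections of `Z` over `U`, so this is the smoothness of `Z` over
the base. -/
lemma smooth_quotient_mk_comp_appLE {X S : Scheme.{u}} (f : X ⟶ S) (I : X.IdealSheafData)
    [Smooth (I.subschemeι ≫ f)] {W : S.Opens} (hW : IsAffineOpen W) (U : X.affineOpens)
    (e : U.1 ≤ f ⁻¹ᵁ W) : ((Ideal.Quotient.mk (I.ideal U)).comp (f.appLE W U.1 e).hom).Smooth := by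
  have h1 := (I.subschemeι ≫ f).smooth_appLE hW (U.2.preimage I.subschemeι)
    (Scheme.Hom.preimage_mono _ e)
  have h2 : (I.subschemeι ≫ f).appLE W (I.subschemeι ⁻¹ᵁ U.1) (Scheme.Hom.preimage_mono _ e) =
      f.appLE W U.1 e ≫ I.subschemeι.app U.1 := by
    rw [← Scheme.Hom.appLE_eq_app, Scheme.Hom.appLE_comp_appLE]
  have h3 : f.appLE W U.1 e ≫ CommRingCat.ofHom (Ideal.Quotient.mk (I.ideal U)) =
      (I.subschemeι ≫ f).appLE W (I.subschemeι ⁻¹ᵁ U.1) (Scheme.Hom.preimage_mono _ e) ≫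
        (I.subschemeObjIso U).hom := by
    rw [h2, I.subschemeι_app U, Category.assoc, Category.assoc, Iso.inv_hom_id, Category.comp_id]
  change (f.appLE W U.1 e ≫ CommRingCat.ofHom (Ideal.Quotient.mk (I.ideal U))).hom.Smooth
  rw [h3]
  exact h1.comp (.of_bijective (ConcreteCategory.bijective_of_isIso (I.subschemeObjIso U).hom))

/-- Blowing up a smooth center in a smooth scheme over an affine base commutes with affine base
change. -/
theorem isPullback_blowupComapMap_of_smooth {X Y S T : Scheme.{u}} [IsAffine S] [IsAffine T]
    {f : X ⟶ S} {g : Y ⟶ X} {q : Y ⟶ T} {t : T ⟶ S} (sq : IsPullback g q f t) [IsAffineHom g]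
    (I : X.IdealSheafData) [Smooth f] [Smooth (I.subschemeι ≫ f)] :
    IsPullback (blowupComapMap I g) (blowupπ (I.comap g)) (blowupπ I) g := by
  refine isPullback_blowupComapMap I g fun U ↦ ?_
  have hUY : g ⁻¹ᵁ U.1 = g ⁻¹ᵁ U.1 ⊓ q ⁻¹ᵁ ⊤ := by simp
  have hpo := (isIso_pushoutSection_iff sq (US := ⊤) (UT := ⊤) (UX := U.1) le_top le_top hUY).mp
    (isIso_pushoutSection_of_isAffineOpen _ _ _ _ (isAffineOpen_top S) (isAffineOpen_top T) U.2)
  have happ : g.appLE U.1 (g ⁻¹ᵁ U.1) le_rfl = g.app U.1 := Scheme.Hom.appLE_eq_app g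
  have h1 := f.smooth_appLE (isAffineOpen_top S) U.2 le_top
  have h2 := smooth_quotient_mk_comp_appLE f I (isAffineOpen_top S) U le_top
  have hpo' := hpo
  rw [happ] at hpo'
  exact isPullback_affineBlowup_of_formallySmooth hpo' (I.ideal U) _ (map_ideal_app I g U)
    h1.formallySmooth h2.formallySmooth h2.flat

/-- Pasting the blow-up square onto the fibre square of `f` exhibits the blow-up of the fibre as the
fibre of `blowupπ I ≫ f`. -/
theorem exists_fiber_iso {X S : Scheme.{u}} [IsAffine S] (f : X ⟶ S) (I : X.IdealSheafData)
    [Smooth f] [Smooth (I.subschemeι ≫ f)] (s : S) :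
    ∃ e : (blowupπ I ≫ f).fiber s ≅ blowup (I.comap (f.fiberι s)),
      e.hom ≫ blowupπ (I.comap (f.fiberι s)) ≫ f.fiberι s =
        (blowupπ I ≫ f).fiberι s ≫ blowupπ I := by
  have sq : IsPullback (f.fiberι s) (f.fiberToSpecResidueField s) f (S.fromSpecResidueField s) :=
    .of_hasPullback _ _
  have : IsAffineHom (f.fiberι s) := MorphismProperty.of_isPullback sq.flip inferInstance
  have h1 := isPullback_blowupComapMap_of_smooth sq I
  have h2 : IsPullback (blowupComapMap I (f.fiberι s))
      (blowupπ (I.comap (f.fiberι s)) ≫ f.fiberToSpecResidueField s) (blowupπ I ≫ f)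
      (S.fromSpecResidueField s) := h1.paste_vert sq
  have h3 : IsPullback ((blowupπ I ≫ f).fiberι s) ((blowupπ I ≫ f).fiberToSpecResidueField s)
      (blowupπ I ≫ f) (S.fromSpecResidueField s) := .of_hasPullback _ _
  refine ⟨h3.isoIsPullback _ _ h2, ?_⟩
  rw [← h1.w, IsPullback.isoIsPullback_hom_fst_assoc]

end SmoothBaseChange

end BlowUp

theorem mainTheorem10 {X : Scheme.{u}}
    (f : X ⟶ Spec (CommRingCat.of (ULift.{u} ℤ)))
    [Smooth f]
    (I : X.IdealSheafData) [Smooth (I.subschemeι ≫ f)] :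
    -- the fibre of the blow-up is the blow-up of the fibre, compatibly with the projections
    (∀ s : Spec (CommRingCat.of (ULift.{u} ℤ)),
      ∃ e : (BlowUp.blowupπ I ≫ f).fiber s ≅ BlowUp.blowup (I.comap (f.fiberι s)),
        e.hom ≫ BlowUp.blowupπ (I.comap (f.fiberι s)) ≫ f.fiberι s =
          (BlowUp.blowupπ I ≫ f).fiberι s ≫ BlowUp.blowupπ I) ∧
    -- local blow-up coordinates at a point `x'` that is closed in its fibre over `(p)`
    (∀ (s : Spec (CommRingCat.of (ULift.{u} ℤ))) (p : ℕ),
      s.asIdeal = Ideal.span {(p : ULift.{u} ℤ)} →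
      ∀ (z : (BlowUp.blowupπ I ≫ f).fiber s), IsClosed {z} →
      ∀ (x' : BlowUp.blowup I), x' = (BlowUp.blowupπ I ≫ f).fiberι s z →
      ∀ (n r : ℕ) (hr : 0 < r) (hrn : r ≤ n)
        (x : Fin n → X.presheaf.stalk (BlowUp.blowupπ I x')),
        BlowUp.IsRegularParametersOver p x →
        BlowUp.stalkIdeal I (BlowUp.blowupπ I x') = Ideal.span {a | ∃ i, i.1 < r ∧ x i = a} →
        -- `x'` lies in the chart of the blow-up belonging to `x₁`
        ∀ (U : X.affineOpens) (hU : BlowUp.blowupπ I x' ∈ U.1) (σ : Γ(X, U.1))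
          (hσ : σ ∈ I.ideal U),
          X.presheaf.germ U.1 (BlowUp.blowupπ I x') hU σ = x ⟨0, hr.trans_le hrn⟩ →
          x' ∈ BlowUp.blowupChart I U σ hσ →
          -- `x₁` is a local equation of the exceptional divisor
          ((BlowUp.blowupπ I).stalkMap x').hom (x ⟨0, hr.trans_le hrn⟩) ∈
            nonZeroDivisors ((BlowUp.blowup I).presheaf.stalk x') ∧
          (BlowUp.stalkIdeal I (BlowUp.blowupπ I x')).map ((BlowUp.blowupπ I).stalkMap x').hom =
            Ideal.span {((BlowUp.blowupπ I).stalkMap x').hom (x ⟨0, hr.trans_le hrn⟩)} ∧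
          -- the elements `x₁, x₂ / x₁, …, xᵣ / x₁, xᵣ₊₁, …, xₙ`
          ∃ xbar : Fin n → (BlowUp.blowup I).presheaf.stalk x',
            xbar ⟨0, hr.trans_le hrn⟩ =
              ((BlowUp.blowupπ I).stalkMap x').hom (x ⟨0, hr.trans_le hrn⟩) ∧
            (∀ i : Fin n, 0 < i.1 → i.1 < r →
              xbar i * ((BlowUp.blowupπ I).stalkMap x').hom (x ⟨0, hr.trans_le hrn⟩) =
                ((BlowUp.blowupπ I).stalkMap x').hom (x i)) ∧
            (∀ i : Fin n, r ≤ i.1 → xbar i = ((BlowUp.blowupπ I).stalkMap x').hom (x i)) ∧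
            -- those that vanish at `x'` extend to regular parameters, in the given places
            (∃ y : Fin n → (BlowUp.blowup I).presheaf.stalk x',
              BlowUp.IsRegularParametersOver p y ∧
              ∀ i, xbar i ∈ IsLocalRing.maximalIdeal ((BlowUp.blowup I).presheaf.stalk x') →
                y i = xbar i) ∧
            -- if all of them vanish at `x'`, then they are regular parameters
            ((∀ i, xbar i ∈ IsLocalRing.maximalIdeal ((BlowUp.blowup I).presheaf.stalk x')) →
              BlowUp.IsRegularParametersOver p xbar)) := 
  ⟨fun s ↦ BlowUp.exists_fiber_iso f I s,
    fun s p _ z hz x' hx' n r hr hrn x hx hI U hU σ hσ hσx hx'U ↦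
      BlowUp.blowup_coordinates f I s p z hz x' hx' n r hr hrn x hx hI U hU σ hσ hσx hx'U⟩
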